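/- Let $\mathbb{M}=\mathbb{F}_2[\tau,\rho]$, and let $\mathcal{A}^{\mathbb{R}}_\star=\mathbb{M}[\tau_0,\tau_1,\dots,\xi_1,\xi_2,\dots]/(\tau_n^2=\tau\xi_{n+1}+\rho\tau_0\xi_{n+1}+\rho\tau_{n+1})$ be the dual $\mathbb{R}$-motivic Steenrod algebra, bigraded by $|\tau|=(0,-1)$, $|\rho|=(-1,-1)$, $|\tau_n|=(2^{n+1}-1,2^n-1)$, $|\xi_n|=(2^{n+1}-2,2^n-1)$. It is a Hopf algebroid with left unit the inclusion of $\mathbb{M}$, right unit $\eta_R(\tau)=\tau+\rho\tau_0$, $\eta_R(\rho)=\rho$, and comultiplication $$\Delta(\xi_n)=\sum_{i=0}^n\xi_{n-i}^{2^i}\otimes\xi_i,\qquad \Delta(\tau_n)=\tau_n\otimes 1+\sum_{i=0}^n\xi_{n-i}^{2^i}\otimes\tau_i\qquad(\xi_0=1).$$ The $\mathbb{R}$-motivic Steenrod algebra $\mathcal{A}^{\mathbb{R}}$ is its graded left $\mathbb{M}$-linear dual (finite sums of homogeneous functionals, where a functional has bidegree $d$ if it lowers the bidegree by $d$), with product $\langle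 x,\varphi\psi\rangle=\sum\langle x'\,\eta_R(\langle x'',\psi\rangle),\varphi\rangle$ for $\Delta(x)=\sum x'\otimes x''$ and with unit the counit. An element $m\in\mathbb{M}$ is identified with $m$ times the unit, and $\mathrm{Sq}^{2k}$, $\mathrm{Sq}^{2k+1}$ are the elements dual to $\xi_1^k$, $\tau_0\xi_1^k$ in the $\mathbb{M}$-basis of $\mathcal{A}^{\mathbb{R}}_\star$ given by the monomials in the $\tau_i,\xi_j$ with all exponents of the $\tau_i$ at most $1$. So $\tau,\rho,\mathrm{Sq}^n$ have bidegrees $(0,1),(1,1),(n,\lfloor n/2\rfloor)$ in $\mathcal{A}^{\mathbb{R}}$. **Proposition.** Let $\chi^{\mathbb{R}}\colon\mathcal{A}^{\mathbb{R}}\to\mathcal{A}^{\mathbb{R}}$ be a bidegree-preserving ring antihomomorphism (additive, $\chi^{\mathbb{R}}(1)=1$, $\chi^{\mathbb{R}}(xy)=\chi^{\mathbb{R}}(y)\chi^{\mathbb{R}}(x)$) which is an involution ($\chi^{\mathbb{R}}\circ\chi^{\mathbb{R}}=\mathrm{id}$). Then $$\chi^{\mathbb{R}}(\tau)=\tau,\quad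 \chi^{\mathbb{R}}(\rho)=\rho,\quad \chi^{\mathbb{R}}(\mathrm{Sq}^1)=\mathrm{Sq}^1,\quad \chi^{\mathbb{R}}(\mathrm{Sq}^2)=\mathrm{Sq}^2+\rho\,\mathrm{Sq}^1,$$ $$\chi^{\mathbb{R}}(\mathrm{Sq}^4)=\mathrm{Sq}^4+\rho\,\mathrm{Sq}^2\mathrm{Sq}^1+\tau\,\mathrm{Sq}^1\mathrm{Sq}^2\mathrm{Sq}^1.$$ -/

import Mathlib

open scoped TensorProduct

noncomputable section

namespace RMotivic

/-! ### The coefficient ring and the dual Steenrod algebra -/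

/-- The coefficient ring `𝔽₂[τ, ρ]` (variable `0` is `τ`, variable `1` is `ρ`). -/
abbrev Coeff : Type := MvPolynomial (Fin 2) (ZMod 2)

abbrev cTau : Coeff := MvPolynomial.X 0

abbrev cRho : Coeff := MvPolynomial.X 1

/-- Polynomials over `Coeff` in `τ₀, τ₁, …` (`Sum.inl n` is `τₙ`) and
`ξ₁, ξ₂, …` (`Sum.inr n` is `ξₙ₊₁`). -/
abbrev PreDual : Type := MvPolynomial (ℕ ⊕ ℕ) Coeff

/-- The relation `τₙ² = τ ξₙ₊₁ + ρ τ₀ ξₙ₊₁ + ρ τₙ₊₁`. -/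
def dualRelation (n : ℕ) : PreDual :=
  MvPolynomial.X (Sum.inl n) ^ 2 -
    (MvPolynomial.C cTau * MvPolynomial.X (Sum.inr n)
      + MvPolynomial.C cRho * MvPolynomial.X (Sum.inl 0) * MvPolynomial.X (Sum.inr n)
      + MvPolynomial.C cRho * MvPolynomial.X (Sum.inl (n + 1)))

def dualIdeal : Ideal PreDual := Ideal.span (Set.range dualRelation)

/-- The dual motivic Steenrod algebra over `ℝ`. Its `Coeff`-algebra structure is the left unit. -/
def Dual : Type := PreDual ⧸ dualIdeal

instance : CommRing Dual := inferInstanceAs (CommRing (PreDual ⧸ dualIdeal))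

instance : Algebra Coeff Dual := inferInstanceAs (Algebra Coeff (PreDual ⧸ dualIdeal))

def Dual.mk : PreDual →ₐ[Coeff] Dual := Ideal.Quotient.mkₐ Coeff dualIdeal

/-- The left unit. -/
def etaL : Coeff →+* Dual := algebraMap Coeff Dual

def dTau (n : ℕ) : Dual := Dual.mk (MvPolynomial.X (Sum.inl n))

/-- The element `ξₙ`, with `ξ₀ = 1`. -/
def dXi : ℕ → Dual
  | 0 => 1
  | n + 1 => Dual.mk (MvPolynomial.X (Sum.inr n))

/-- The right unit: `η_R(τ) = τ + ρ τ₀`, `η_R(ρ) = ρ`. -/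
def etaR : Coeff →+* Dual :=
  MvPolynomial.eval₂Hom (etaL.comp MvPolynomial.C)
    ![etaL cTau + etaL cRho * dTau 0, etaL cRho]

theorem dTau_sq (n : ℕ) : dTau n ^ 2 =
    etaL cTau * dXi (n + 1) + etaL cRho * dTau 0 * dXi (n + 1) + etaL cRho * dTau (n + 1) := by
  have h : Dual.mk (dualRelation n) = 0 :=
    Ideal.Quotient.eq_zero_iff_mem.mpr (Ideal.subset_span ⟨n, rfl⟩)
  have hC : ∀ c : Coeff, Dual.mk (MvPolynomial.C c) = etaL c := fun c => Dual.mk.commutes c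
  rw [dualRelation, map_sub, sub_eq_zero] at h
  simp only [map_add, map_mul, map_pow, hC] at h
  exact h

/-- Ring homomorphisms out of the dual Steenrod algebra. -/
def Dual.lift {S : Type*} [CommRing S] (f : Coeff →+* S) (t x : ℕ → S)
    (h : ∀ n, t n ^ 2 = f cTau * x n + f cRho * t 0 * x n + f cRho * t (n + 1)) : Dual →+* S :=
  Ideal.Quotient.lift dualIdeal (MvPolynomial.eval₂Hom f (Sum.elim t x)) (by
    intro a ha
    have hle : dualIdeal ≤ RingHom.ker (MvPolynomial.eval₂Hom f (Sum.elim t x)) := by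
      refine Ideal.span_le.mpr ?_
      rintro _ ⟨n, rfl⟩
      simp [dualRelation, RingHom.mem_ker, h n]
    exact hle ha)

section lift

variable {S : Type*} [CommRing S] (f : Coeff →+* S) (t x : ℕ → S)
    (h : ∀ n, t n ^ 2 = f cTau * x n + f cRho * t 0 * x n + f cRho * t (n + 1))

theorem Dual.lift_mk (p : PreDual) :
    Dual.lift f t x h (Dual.mk p) = MvPolynomial.eval₂Hom f (Sum.elim t x) p := rfl

@[simp] theorem Dual.lift_etaL (c : Coeff) : Dual.lift f t x h (etaL c) = f c :=
  (Dual.lift_mk f t x h (MvPolynomial.C c)).trans (by simp)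

@[simp] theorem Dual.lift_dTau (n : ℕ) : Dual.lift f t x h (dTau n) = t n :=
  (Dual.lift_mk f t x h _).trans (by simp)

@[simp] theorem Dual.lift_dXi (n : ℕ) : Dual.lift f t x h (dXi (n + 1)) = x n :=
  (Dual.lift_mk f t x h _).trans (by simp)

end lift

theorem Dual.hom_ext {S : Type*} [CommRing S] {f g : Dual →+* S}
    (hc : ∀ c, f (etaL c) = g (etaL c)) (ht : ∀ n, f (dTau n) = g (dTau n))
    (hx : ∀ n, f (dXi (n + 1)) = g (dXi (n + 1))) : f = g := by
  refine Ideal.Quotient.ringHom_ext (MvPolynomial.ringHom_ext hc ?_)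
  rintro (n | n)
  · exact ht n
  · exact hx n

/-- The dual Steenrod algebra, with `Coeff`-algebra structure the right unit. -/
def DualR : Type := Dual

instance : CommRing DualR := inferInstanceAs (CommRing Dual)

instance : Algebra Coeff DualR := RingHom.toAlgebra (R := Coeff) (S := Dual) etaR

/-- The tensor product of bimodules `A ⊗ A`: the relations are `a η_R(m) ⊗ b = a ⊗ η_L(m) b`. -/
abbrev Dual2 : Type := DualR ⊗[Coeff] Dual

/-- `a ↦ a ⊗ 1`. -/
def inL : Dual →+* Dual2 :=
  (Algebra.TensorProduct.includeLeftRingHom : DualR →+* DualR ⊗[Coeff] Dual)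

/-- `b ↦ 1 ⊗ b`. -/
def inR : Dual →+* Dual2 :=
  ((Algebra.TensorProduct.includeRight : Dual →ₐ[Coeff] DualR ⊗[Coeff] Dual) : Dual →+* Dual2)

theorem inR_etaL (c : Coeff) : inR (etaL c) = inL (etaR c) :=
  (Algebra.TensorProduct.includeRight : Dual →ₐ[Coeff] DualR ⊗[Coeff] Dual).commutes c

@[simp] theorem etaR_cTau : etaR cTau = etaL cTau + etaL cRho * dTau 0 := by simp [etaR]

@[simp] theorem etaR_cRho : etaR cRho = etaL cRho := by simp [etaR]

theorem two_eq_zero_of_hom {S : Type*} [CommRing S] (f : Coeff →+* S) : (2 : S) = 0 := by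
  have h : (2 : Coeff) = 0 := CharTwo.two_eq_zero
  have h' := congrArg f h
  rwa [map_ofNat, map_zero] at h'

theorem sum_sq_of_two {S : Type*} [CommRing S] (h2 : (2 : S) = 0) {ι : Type*} (s : Finset ι)
    (f : ι → S) : (∑ i ∈ s, f i) ^ 2 = ∑ i ∈ s, f i ^ 2 := by
  classical
  induction s using Finset.induction_on with
  | empty => simp
  | insert a s ha ih =>
    rw [Finset.sum_insert ha, Finset.sum_insert ha, ← ih]
    linear_combination (f a * ∑ i ∈ s, f i) * h2

theorem sum_pow_of_two {S : Type*} [CommRing S] (h2 : (2 : S) = 0) {ι : Type*} (s : Finset ι)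
    (f : ι → S) (k : ℕ) : (∑ i ∈ s, f i) ^ 2 ^ k = ∑ i ∈ s, f i ^ 2 ^ k := by
  induction k with
  | zero => simp
  | succ k ih => rw [pow_succ, pow_mul, ih, sum_sq_of_two h2]; simp [pow_mul]

/-- `τₙ ⊗ 1 + ∑ᵢ ξₙ₋ᵢ^(2^i) ⊗ τᵢ`. -/
def comulTau (n : ℕ) : Dual2 :=
  inL (dTau n) + ∑ i ∈ Finset.range (n + 1), inL (dXi (n - i) ^ 2 ^ i) * inR (dTau i)

/-- `∑ᵢ ξₙ₋ᵢ^(2^i) ⊗ ξᵢ`. -/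
def comulXi (n : ℕ) : Dual2 :=
  ∑ i ∈ Finset.range (n + 1), inL (dXi (n - i) ^ 2 ^ i) * inR (dXi i)

theorem comulTau_sq (n : ℕ) : comulTau n ^ 2 =
    inL (etaL cTau) * comulXi (n + 1) + inL (etaL cRho) * comulTau 0 * comulXi (n + 1)
      + inL (etaL cRho) * comulTau (n + 1) := by
  have h2 : (2 : Dual2) = 0 := two_eq_zero_of_hom (inL.comp etaL)
  have e1 : comulXi (n + 1) = inL (dXi (n + 1)) + ∑ i ∈ Finset.range (n + 1),
      inL (dXi (n - i) ^ 2 ^ (i + 1)) * inR (dXi (i + 1)) := by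
    rw [comulXi, Finset.sum_range_succ', add_comm]
    simp [dXi]
  have e2 : comulTau (n + 1) = inL (dTau (n + 1)) + (inL (dXi (n + 1)) * inR (dTau 0)
      + ∑ i ∈ Finset.range (n + 1), inL (dXi (n - i) ^ 2 ^ (i + 1)) * inR (dTau (i + 1))) := by
    rw [comulTau, Finset.sum_range_succ', add_comm (∑ i ∈ _, _)]
    simp
  have e3 : comulTau 0 = inL (dTau 0) + inR (dTau 0) := by simp [comulTau, dXi]
  have e4 : comulTau n ^ 2 = inL (dTau n ^ 2) + ∑ i ∈ Finset.range (n + 1),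
      inL (dXi (n - i) ^ 2 ^ (i + 1)) * inR (dTau i ^ 2) := by
    have : ∀ a b : Dual2, (a + b) ^ 2 = a ^ 2 + b ^ 2 := fun a b => by
      linear_combination a * b * h2
    rw [comulTau, this, sum_sq_of_two h2, map_pow]
    congr 1
    refine Finset.sum_congr rfl fun i _ => ?_
    rw [mul_pow, ← map_pow, ← map_pow, ← pow_mul, pow_succ 2 i]
  have e5 : ∑ i ∈ Finset.range (n + 1), inL (dXi (n - i) ^ 2 ^ (i + 1)) * inR (dTau i ^ 2) =
      (inL (etaL cTau) + inL (etaL cRho) * inL (dTau 0) + inL (etaL cRho) * inR (dTau 0)) *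
        ∑ i ∈ Finset.range (n + 1), inL (dXi (n - i) ^ 2 ^ (i + 1)) * inR (dXi (i + 1))
      + inL (etaL cRho) *
        ∑ i ∈ Finset.range (n + 1), inL (dXi (n - i) ^ 2 ^ (i + 1)) * inR (dTau (i + 1)) := by
    rw [Finset.mul_sum, Finset.mul_sum, ← Finset.sum_add_distrib]
    refine Finset.sum_congr rfl fun i _ => ?_
    rw [dTau_sq]
    simp only [map_add, map_mul, inR_etaL, etaR_cTau, etaR_cRho]
    ring
  rw [e4, e5, e1, e2, e3, dTau_sq]
  simp only [map_add, map_mul]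
  linear_combination (-inL (etaL cRho) * inL (dXi (n + 1)) * inR (dTau 0)) * h2

/-- The comultiplication of the Hopf algebroid. -/
def comul : Dual →+* Dual2 :=
  Dual.lift (inL.comp etaL) comulTau (fun n => comulXi (n + 1)) comulTau_sq

/-- The counit of the Hopf algebroid: every `τₙ` and every `ξₙ`, `n ≥ 1`, goes to `0`. -/
def counit : Dual →+* Coeff :=
  Dual.lift (RingHom.id Coeff) (fun _ => 0) (fun _ => 0) (by simp)

@[simp] theorem comul_etaL (c : Coeff) : comul (etaL c) = inL (etaL c) := by simp [comul]
@[simp] theorem comul_dTau (n : ℕ) : comul (dTau n) = comulTau n := by simp [comul]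
@[simp] theorem comul_dXi (n : ℕ) : comul (dXi n) = comulXi n := by
  cases n with
  | zero => simp [comulXi, dXi]
  | succ n => simp [comul]

/-! ### The ring of functionals -/

theorem smul_eq_etaL_mul (c : Coeff) (a : Dual) : c • a = etaL c * a := Algebra.smul_def c a

/-- Ring homomorphisms out of `A ⊗ A`. -/
def Dual2.lift {S : Type*} [CommRing S] (f g : Dual →+* S)
    (h : ∀ c, f (etaR c) = g (etaL c)) : Dual2 →+* S :=
  letI : Algebra Coeff S := (g.comp etaL).toAlgebra
  ((Algebra.TensorProduct.lift
    ({ (f : Dual →+* S) with commutes' := h } : DualR →ₐ[Coeff] S)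
    ({ g with commutes' := fun _ => rfl } : Dual →ₐ[Coeff] S)
    (fun _ _ => Commute.all _ _) : DualR ⊗[Coeff] Dual →ₐ[Coeff] S) : Dual2 →+* S)

section lift2

variable {S : Type*} [CommRing S] (f g : Dual →+* S) (h : ∀ c, f (etaR c) = g (etaL c))

@[simp] theorem Dual2.lift_inL (a : Dual) : Dual2.lift f g h (inL a) = f a := by
  let _ : Algebra Coeff S := (g.comp etaL).toAlgebra
  exact (Algebra.TensorProduct.lift_tmul
    ({ (f : Dual →+* S) with commutes' := h } : DualR →ₐ[Coeff] S)
    ({ g with commutes' := fun _ => rfl } : Dual →ₐ[Coeff] S)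
    (fun _ _ => Commute.all _ _) a 1).trans ((congrArg (f a * ·) (map_one g)).trans (mul_one _))

@[simp] theorem Dual2.lift_inR (a : Dual) : Dual2.lift f g h (inR a) = g a := by
  let _ : Algebra Coeff S := (g.comp etaL).toAlgebra
  exact (Algebra.TensorProduct.lift_tmul
    ({ (f : Dual →+* S) with commutes' := h } : DualR →ₐ[Coeff] S)
    ({ g with commutes' := fun _ => rfl } : Dual →ₐ[Coeff] S)
    (fun _ _ => Commute.all _ _) 1 a).trans ((congrArg (· * g a) (map_one f)).trans (one_mul _))

end lift2

theorem inL_mul_inR (a b : Dual) : inL a * inR b = (show DualR from a) ⊗ₜ[Coeff] b := by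
  change ((show DualR from a) ⊗ₜ[Coeff] (1 : Dual)) * ((1 : DualR) ⊗ₜ[Coeff] b) = _
  rw [Algebra.TensorProduct.tmul_mul_tmul, mul_one, one_mul]

theorem Dual2.induction {p : Dual2 → Prop} (z : Dual2) (h : ∀ a b : Dual, p (inL a * inR b))
    (hadd : ∀ x y, p x → p y → p (x + y)) : p z := by
  induction z using TensorProduct.induction_on with
  | zero => simpa using h 0 0
  | tmul x y => exact (inL_mul_inR x y) ▸ h x y
  | add x y hx hy => exact hadd x y hx hy

/-- `id ⊗ ψ : A ⊗ A → A ⊗ 𝔽₂[τ, ρ] = A`, that is `a ⊗ b ↦ a η_R(ψ(b))`. -/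
def contract (ψ : Dual →ₗ[Coeff] Coeff) : Dual2 →+ Dual :=
  (((TensorProduct.rid Coeff DualR).toLinearMap ∘ₗ LinearMap.lTensor DualR ψ).toAddMonoidHom :
    Dual2 →+ DualR)

theorem contract_tmul (ψ : Dual →ₗ[Coeff] Coeff) (a b : Dual) :
    contract ψ (inL a * inR b) = a * etaR (ψ b) := by
  rw [inL_mul_inR]
  change (TensorProduct.rid Coeff DualR) ((show DualR from a) ⊗ₜ[Coeff] (ψ b)) = _
  rw [TensorProduct.rid_tmul, Algebra.smul_def, mul_comm]
  rfl

theorem contract_inL_mul (ψ : Dual →ₗ[Coeff] Coeff) (a : Dual) (z : Dual2) :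
    contract ψ (inL a * z) = a * contract ψ z := by
  induction z using Dual2.induction with
  | h b c => rw [← mul_assoc, ← map_mul, contract_tmul, contract_tmul, mul_assoc]
  | hadd x y hx hy => rw [mul_add, map_add, map_add, hx, hy, mul_add]

/-- The operator `a ↦ ∑ a' η_R(ψ(a''))`, where `∑ a' ⊗ a''` is the comultiplication of `a`. -/
def cap (ψ : Dual →ₗ[Coeff] Coeff) : Dual →ₗ[Coeff] Dual where
  toFun a := contract ψ (comul a)
  map_add' a b := by rw [map_add, map_add]
  map_smul' c a := by
    rw [smul_eq_etaL_mul, map_mul, comul_etaL, contract_inL_mul, RingHom.id_apply,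
      smul_eq_etaL_mul]

theorem cap_apply (ψ : Dual →ₗ[Coeff] Coeff) (a : Dual) : cap ψ a = contract ψ (comul a) := rfl

@[simp] theorem counit_etaL (c : Coeff) : counit (etaL c) = c := by simp [counit]

theorem counit_dXi (n : ℕ) : counit (dXi n) = if n = 0 then 1 else 0 := by
  cases n with
  | zero => simp [dXi]
  | succ n => simp [counit]

@[simp] theorem counit_dTau (n : ℕ) : counit (dTau n) = 0 := by simp [counit]

theorem counit_etaR (c : Coeff) : counit (etaR c) = c := by
  have : counit.comp etaR = RingHom.id Coeff := by
    refine MvPolynomial.ringHom_ext (fun r => ?_) (fun i => ?_)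
    · simp [etaR]
    · fin_cases i
      · change counit (etaR cTau) = cTau
        simp
      · change counit (etaR cRho) = cRho
        simp
  exact congrArg (fun f => f c) this

/-- The counit, as a functional. -/
def counitL : Dual →ₗ[Coeff] Coeff where
  toFun := counit
  map_add' := map_add counit
  map_smul' c a := by rw [smul_eq_etaL_mul, map_mul]; simp

theorem counit_cap (ψ : Dual →ₗ[Coeff] Coeff) (a : Dual) : counit (cap ψ a) = ψ a := by
  let F : Dual2 →+* Dual := Dual2.lift (etaL.comp counit) (RingHom.id Dual) (by
    intro c; simp [counit_etaR])
  have h1 : F.comp comul = RingHom.id Dual := by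
    refine Dual.hom_ext (fun c => ?_) (fun n => ?_) (fun n => ?_)
    · simp [F]
    · simp only [RingHom.comp_apply, comul_dTau, comulTau, map_add, map_sum,
        map_mul, RingHom.id_apply, F, Dual2.lift_inL, Dual2.lift_inR]
      rw [Finset.sum_eq_single n]
      · simp [dXi]
      · intro i hi hne
        have : n - i ≠ 0 := by have := Finset.mem_range.mp hi; omega
        simp [counit_dXi, this]
      · simp
    · simp only [RingHom.comp_apply, comul_dXi, comulXi, map_sum,
        map_mul, RingHom.id_apply, F, Dual2.lift_inL, Dual2.lift_inR]
      rw [Finset.sum_eq_single (n + 1)]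
      · simp [dXi]
      · intro i hi hne
        have : n + 1 - i ≠ 0 := by have := Finset.mem_range.mp hi; omega
        simp [counit_dXi, this]
      · simp
  have h2 : ∀ z : Dual2, counit (contract ψ z) = ψ (F z) := by
    intro z
    induction z using Dual2.induction with
    | h x y =>
      rw [contract_tmul, map_mul, map_mul, counit_etaR]
      simp [F, ← smul_eq_etaL_mul]
    | hadd x y hx hy => rw [map_add, map_add, map_add, map_add, ← hx, ← hy]
  rw [cap_apply, h2]
  exact congrArg (fun f : Dual →+* Dual => ψ (f a)) h1

theorem cap_counitL (a : Dual) : cap counitL a = a := by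
  let F : Dual2 →+* Dual := Dual2.lift (RingHom.id Dual) (etaR.comp counit) (by intro c; simp)
  have h1 : F.comp comul = RingHom.id Dual := by
    refine Dual.hom_ext (fun c => ?_) (fun n => ?_) (fun n => ?_)
    · simp [F]
    · simp [comulTau, F]
    · simp only [RingHom.comp_apply, comul_dXi, comulXi, map_sum,
        map_mul, RingHom.id_apply, F, Dual2.lift_inL, Dual2.lift_inR]
      rw [Finset.sum_eq_single 0]
      · simp [dXi]
      · intro i hi hne
        simp [counit_dXi, hne]
      · simp
  have h2 : ∀ z : Dual2, contract counitL z = F z := by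
    intro z
    induction z using Dual2.induction with
    | h x y => rw [contract_tmul, map_mul]; simp [F, counitL]
    | hadd x y hx hy => rw [map_add, map_add, ← hx, ← hy]
  rw [cap_apply, h2]
  exact congrArg (fun f : Dual →+* Dual => f a) h1

/-! ### Coassociativity, used for the associativity of the product of functionals -/

/-- `A ⊗ A` with the `Coeff`-algebra structure of the left unit of the left factor. -/
def Dual2L : Type := Dual2

instance : CommRing Dual2L := inferInstanceAs (CommRing Dual2)

instance : Algebra Coeff Dual2L := RingHom.toAlgebra (R := Coeff) (S := Dual2) (inL.comp etaL)

/-- The triple tensor product of bimodules `A ⊗ A ⊗ A`. -/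
abbrev Dual3 : Type := DualR ⊗[Coeff] Dual2L

def inL3 : Dual →+* Dual3 :=
  (Algebra.TensorProduct.includeLeftRingHom : DualR →+* DualR ⊗[Coeff] Dual2L)

def inR3 : Dual2 →+* Dual3 :=
  ((Algebra.TensorProduct.includeRight : Dual2L →ₐ[Coeff] DualR ⊗[Coeff] Dual2L) :
    Dual2L →+* Dual3)

theorem inR3_inL_etaL (c : Coeff) : inR3 (inL (etaL c)) = inL3 (etaR c) :=
  (Algebra.TensorProduct.includeRight : Dual2L →ₐ[Coeff] DualR ⊗[Coeff] Dual2L).commutes c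

theorem comul_etaR (c : Coeff) : comul (etaR c) = inR (etaR c) := by
  have : comul.comp etaR = inR.comp etaR := by
    refine MvPolynomial.ringHom_ext (fun r => ?_) (fun i => ?_)
    · simp [etaR, inR_etaL]
    · fin_cases i
      · change comul (etaR cTau) = inR (etaR cTau)
        simp [inR_etaL, comulTau, dXi]
        ring
      · change comul (etaR cRho) = inR (etaR cRho)
        simp [inR_etaL]
  exact congrArg (fun f => f c) this

/-- `a ⊗ b ↦ a ⊗ b ⊗ 1`. -/
def in12 : Dual2 →+* Dual3 :=
  Dual2.lift inL3 (inR3.comp inL) (fun c => (inR3_inL_etaL c).symm)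

/-- `id ⊗ Δ`. -/
def idComul : Dual2 →+* Dual3 :=
  Dual2.lift inL3 (inR3.comp comul) (fun c => by simp [inR3_inL_etaL])

/-- `Δ ⊗ id`. -/
def comulId : Dual2 →+* Dual3 :=
  Dual2.lift (in12.comp comul) (inR3.comp inR)
    (fun c => by simp [comul_etaR, in12, inR_etaL])

theorem coassoc_aux {S : Type*} [CommRing S] (h2 : (2 : S) = 0) (a b : Dual →+* S) (y : ℕ → S)
    (n : ℕ) :
    ∑ i ∈ Finset.range (n + 1), a (dXi (n - i)) ^ 2 ^ i *
      ∑ j ∈ Finset.range (i + 1), b (dXi (i - j)) ^ 2 ^ j * y j =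
    ∑ j ∈ Finset.range (n + 1), (∑ k ∈ Finset.range (n - j + 1),
      a (dXi (n - j - k)) ^ 2 ^ k * b (dXi k)) ^ 2 ^ j * y j := by
  simp_rw [sum_pow_of_two h2, Finset.mul_sum, Finset.sum_mul, Finset.sum_sigma']
  refine Finset.sum_nbij' (fun p => ⟨p.2, p.1 - p.2⟩) (fun p => ⟨p.1 + p.2, p.1⟩) ?_ ?_ ?_ ?_ ?_
  · rintro ⟨i, j⟩ h; simp only [Finset.mem_sigma, Finset.mem_range] at h ⊢; omega
  · rintro ⟨i, j⟩ h; simp only [Finset.mem_sigma, Finset.mem_range] at h ⊢; omega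
  · rintro ⟨i, j⟩ h
    simp only [Finset.mem_sigma, Finset.mem_range] at h
    have : j + (i - j) = i := by omega
    simp [this]
  · rintro ⟨i, j⟩ h; simp
  · rintro ⟨i, j⟩ h
    simp only [Finset.mem_sigma, Finset.mem_range] at h
    obtain ⟨k, rfl⟩ : ∃ k, i = j + k := ⟨i - j, by omega⟩
    have e : n - j - k = n - (j + k) := by omega
    simp only [Nat.add_sub_cancel_left, e]
    rw [mul_pow, ← pow_mul, ← pow_add, add_comm k j]
    ring

theorem coassoc (a : Dual) : idComul (comul a) = comulId (comul a) := by
  have h2 : (2 : Dual3) = 0 := two_eq_zero_of_hom (inL3.comp etaL)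
  have h : idComul.comp comul = comulId.comp comul := by
    refine Dual.hom_ext (fun c => ?_) (fun n => ?_) (fun n => ?_)
    · simp [idComul, comulId, in12]
    · have := coassoc_aux h2 inL3 (inR3.comp inL) (fun j => inR3 (inR (dTau j))) n
      simp only [RingHom.comp_apply] at this
      simp only [RingHom.comp_apply, comul_dTau, comul_dXi, comulTau, comulXi, idComul, comulId,
        in12, map_add, map_sum, map_mul, map_pow, Dual2.lift_inL, Dual2.lift_inR, mul_add,
        Finset.sum_add_distrib, this, add_assoc]
    · have := coassoc_aux h2 inL3 (inR3.comp inL) (fun j => inR3 (inR (dXi j))) (n + 1)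
      simp only [RingHom.comp_apply] at this
      simp only [RingHom.comp_apply, comul_dXi, comulXi, idComul, comulId,
        in12, map_sum, map_mul, map_pow, Dual2.lift_inL, Dual2.lift_inR, this]
  exact congrArg (fun f : Dual →+* Dual3 => f a) h

/-- `a ⊗ b ⊗ c ↦ a η_R(ψ(b η_R(φ(c))))`. -/
def contract3 (ψ φ : Dual →ₗ[Coeff] Coeff) : Dual3 →+ Dual :=
  let θ : Dual2L →ₗ[Coeff] Coeff :=
    { toFun := fun z => ψ (contract φ z)
      map_add' := fun x y => by
        rw [← map_add]; exact congrArg ψ (map_add (contract φ) x y)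
      map_smul' := fun c z => by
        rw [Algebra.smul_def, RingHom.id_apply, ← map_smul, smul_eq_etaL_mul]
        exact congrArg ψ (contract_inL_mul φ (etaL c) z) }
  (((TensorProduct.rid Coeff DualR).toLinearMap ∘ₗ LinearMap.lTensor DualR θ).toAddMonoidHom :
    Dual3 →+ DualR)

theorem contract3_tmul (ψ φ : Dual →ₗ[Coeff] Coeff) (a : Dual) (z : Dual2) :
    contract3 ψ φ (inL3 a * inR3 z) = a * etaR (ψ (contract φ z)) := by
  have h : inL3 a * inR3 z = (show DualR from a) ⊗ₜ[Coeff] (show Dual2L from z) := by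
    change ((show DualR from a) ⊗ₜ[Coeff] (1 : Dual2L)) *
      ((1 : DualR) ⊗ₜ[Coeff] (show Dual2L from z)) = _
    rw [Algebra.TensorProduct.tmul_mul_tmul, mul_one, one_mul]
  rw [h]
  change (TensorProduct.rid Coeff DualR)
    ((show DualR from a) ⊗ₜ[Coeff] (ψ (contract φ z))) = _
  rw [TensorProduct.rid_tmul, Algebra.smul_def, mul_comm]
  rfl

theorem cap_comp_cap (ψ φ : Dual →ₗ[Coeff] Coeff) (a : Dual) :
    cap (ψ ∘ₗ cap φ) a = cap ψ (cap φ a) := by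
  have h1 : ∀ z : Dual2, contract (ψ ∘ₗ cap φ) z = contract3 ψ φ (idComul z) := by
    intro z
    induction z using Dual2.induction with
    | h x y =>
      rw [contract_tmul, map_mul]
      simp only [idComul, Dual2.lift_inL, Dual2.lift_inR, RingHom.comp_apply, contract3_tmul]
      rfl
    | hadd x y hx hy => simp only [map_add, hx, hy]
  have h3 : ∀ (z : Dual2) (b : Dual), contract ψ (z * inR (etaR (φ b))) =
      contract3 ψ φ (in12 z * inR3 (inR b)) := by
    intro z b
    induction z using Dual2.induction with
    | h x y =>
      rw [map_mul in12]
      simp only [in12, Dual2.lift_inL, Dual2.lift_inR, RingHom.comp_apply]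
      rw [mul_assoc, mul_assoc, ← map_mul, ← map_mul, contract3_tmul, contract_tmul,
        contract_tmul]
    | hadd x y hx hy => simp only [add_mul, map_add, hx, hy]
  have h2 : ∀ z : Dual2, contract ψ (comul (contract φ z)) = contract3 ψ φ (comulId z) := by
    intro z
    induction z using Dual2.induction with
    | h x y =>
      rw [contract_tmul, map_mul comul, map_mul comulId, comul_etaR, h3]
      simp [comulId]
    | hadd x y hx hy => simp only [map_add, hx, hy]
  rw [cap_apply, cap_apply, cap_apply, h1, h2, coassoc]

/-! ### The ring of functionals -/

/-- The ring `Hom(A, 𝔽₂[τ, ρ])` of left linear functionals. -/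
def Functional : Type := Dual →ₗ[Coeff] Coeff

instance : AddCommGroup Functional := inferInstanceAs (AddCommGroup (Dual →ₗ[Coeff] Coeff))

instance : Module Coeff Functional := inferInstanceAs (Module Coeff (Dual →ₗ[Coeff] Coeff))

/-- The value `⟨x, φ⟩`. -/
def Functional.eval (φ : Functional) : Dual →ₗ[Coeff] Coeff := φ

/-- The product: `⟨x, φ ψ⟩ = ∑ ⟨x' η_R(⟨x'', ψ⟩), φ⟩`, where `∑ x' ⊗ x''` is the
comultiplication of `x`. -/
instance : Mul Functional := ⟨fun φ ψ => φ.eval ∘ₗ cap ψ.eval⟩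

/-- The identity is the counit. -/
instance : One Functional := ⟨counitL⟩

@[ext] theorem Functional.ext {φ ψ : Functional} (h : ∀ x, φ.eval x = ψ.eval x) : φ = ψ :=
  LinearMap.ext h

theorem Functional.eval_mul (φ ψ : Functional) (x : Dual) :
    (φ * ψ).eval x = φ.eval (cap ψ.eval x) := rfl

theorem cap_add (φ ψ : Dual →ₗ[Coeff] Coeff) (a : Dual) :
    cap (φ + ψ) a = cap φ a + cap ψ a := by
  have : ∀ z : Dual2, contract (φ + ψ) z = contract φ z + contract ψ z := by
    intro z
    induction z using Dual2.induction with
    | h x y => simp [contract_tmul, mul_add]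
    | hadd x y hx hy => simp only [map_add, hx, hy]; abel
  exact this _

theorem cap_zero (a : Dual) : cap 0 a = 0 := by
  have h := cap_add 0 0 a
  simpa using h

instance : Ring Functional :=
  { (inferInstance : AddCommGroup Functional), (inferInstance : Mul Functional),
    (inferInstance : One Functional) with
    left_distrib := fun φ ψ χ => Functional.ext fun x =>
      (congrArg φ.eval (cap_add ψ.eval χ.eval x)).trans (map_add φ.eval _ _)
    right_distrib := fun _ _ _ => rfl
    zero_mul := fun _ => rfl
    mul_zero := fun φ => Functional.ext fun x =>
      (congrArg φ.eval (cap_zero x)).trans (map_zero φ.eval)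
    mul_assoc := fun φ ψ χ => Functional.ext fun x =>
      congrArg φ.eval (cap_comp_cap ψ.eval χ.eval x).symm
    one_mul := fun φ => Functional.ext fun x => counit_cap φ.eval x
    mul_one := fun φ => Functional.ext fun x => congrArg φ.eval (cap_counitL x) }

/-! ### Bidegrees -/

/-- Homological bidegrees of `τ` and `ρ`. -/
def coeffWeight : Fin 2 → ℤ × ℤ := ![(0, -1), (-1, -1)]

/-- Homological bidegrees: `|τₙ| = (2^(n+1) - 1, 2^n - 1)` and
`|ξₙ₊₁| = (2^(n+2) - 2, 2^(n+1) - 1)`. -/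
def genWeight : ℕ ⊕ ℕ → ℤ × ℤ :=
  Sum.elim (fun n => (2 ^ (n + 1) - 1, 2 ^ n - 1)) (fun n => (2 ^ (n + 2) - 2, 2 ^ (n + 1) - 1))

/-- The homogeneous elements of bidegree `d` of the coefficient ring. -/
def coeffPiece (d : ℤ × ℤ) : AddSubgroup Coeff :=
  (MvPolynomial.weightedHomogeneousSubmodule (ZMod 2) coeffWeight d).toAddSubgroup

/-- The homogeneous elements of bidegree `d` of the dual Steenrod algebra: sums of elements `c m`
with `c` a homogeneous coefficient and `m` a monomial in the `τₙ` and `ξₙ`, of total bidegree `d`. -/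
def dualPiece (d : ℤ × ℤ) : AddSubgroup Dual :=
  AddSubgroup.closure {x | ∃ (k : ℤ × ℤ) (c : Coeff) (e : ℕ ⊕ ℕ →₀ ℕ), c ∈ coeffPiece k ∧
    k + Finsupp.weight genWeight e = d ∧ x = c • Dual.mk (MvPolynomial.monomial e 1)}

/-- The functionals of cohomological bidegree `d`, lowering the homological bidegree by `d`. -/
def functionalPiece (d : ℤ × ℤ) : AddSubgroup Functional where
  carrier := {φ | ∀ k, ∀ x ∈ dualPiece k, φ.eval x ∈ coeffPiece (k - d)}
  zero_mem' _ _ _ := (coeffPiece _).zero_mem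
  add_mem' hφ hψ k x hx := (coeffPiece _).add_mem (hφ k x hx) (hψ k x hx)
  neg_mem' hφ k x hx := (coeffPiece _).neg_mem (hφ k x hx)

theorem coeffPiece_mul {k l : ℤ × ℤ} {a b : Coeff} (ha : a ∈ coeffPiece k)
    (hb : b ∈ coeffPiece l) : a * b ∈ coeffPiece (k + l) :=
  MvPolynomial.IsWeightedHomogeneous.mul ha hb

theorem coeffPiece_one : (1 : Coeff) ∈ coeffPiece 0 :=
  MvPolynomial.isWeightedHomogeneous_one _ _

theorem cTau_mem : cTau ∈ coeffPiece (0, -1) :=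
  MvPolynomial.isWeightedHomogeneous_X _ coeffWeight 0

theorem cRho_mem : cRho ∈ coeffPiece (-1, -1) :=
  MvPolynomial.isWeightedHomogeneous_X _ coeffWeight 1

theorem C_mem (r : ZMod 2) : (MvPolynomial.C r : Coeff) ∈ coeffPiece 0 :=
  MvPolynomial.isWeightedHomogeneous_C coeffWeight r

theorem monomial_mem {k : ℤ × ℤ} {c : Coeff} (hc : c ∈ coeffPiece k) (e : ℕ ⊕ ℕ →₀ ℕ) :
    etaL c * Dual.mk (MvPolynomial.monomial e 1) ∈ dualPiece (k + Finsupp.weight genWeight e) :=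
  AddSubgroup.subset_closure ⟨k, c, e, hc, rfl, (smul_eq_etaL_mul _ _).symm⟩

theorem mem_of_eq {ι S : Type*} [AddGroup S] (P : ι → AddSubgroup S) {k l : ι} {x : S}
    (hx : x ∈ P k) (h : k = l) : x ∈ P l := h ▸ hx

theorem closure_mul_mem {S : Type*} [Ring S] {s t u : Set S}
    (h : ∀ x ∈ s, ∀ y ∈ t, x * y ∈ AddSubgroup.closure u) {x y : S}
    (hx : x ∈ AddSubgroup.closure s) (hy : y ∈ AddSubgroup.closure t) :
    x * y ∈ AddSubgroup.closure u := by
  induction hx using AddSubgroup.closure_induction with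
  | mem x hx =>
    induction hy using AddSubgroup.closure_induction with
    | mem y hy => exact h x hx y hy
    | zero => simp
    | add y z _ _ h1 h2 => rw [mul_add]; exact add_mem h1 h2
    | neg y _ h => rw [mul_neg]; exact neg_mem h
  | zero => simp
  | add x z _ _ h1 h2 => rw [add_mul]; exact add_mem h1 h2
  | neg x _ h => rw [neg_mul]; exact neg_mem h

theorem dualPiece_mul {k l : ℤ × ℤ} {x y : Dual} (hx : x ∈ dualPiece k) (hy : y ∈ dualPiece l) :
    x * y ∈ dualPiece (k + l) := by
  refine closure_mul_mem ?_ hx hy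
  rintro _ ⟨k₁, c, e, hc, rfl, rfl⟩ _ ⟨k₂, c', e', hc', rfl, rfl⟩
  have := monomial_mem (coeffPiece_mul hc hc') (e + e')
  have h : c • Dual.mk (MvPolynomial.monomial e 1) * c' • Dual.mk (MvPolynomial.monomial e' 1) =
      etaL (c * c') * Dual.mk (MvPolynomial.monomial (e + e') 1) := by
    rw [smul_eq_etaL_mul, smul_eq_etaL_mul, mul_mul_mul_comm, ← map_mul, ← map_mul,
      MvPolynomial.monomial_mul, one_mul]
  rw [h]
  exact mem_of_eq dualPiece this (by rw [map_add]; abel)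

theorem etaL_mem {k : ℤ × ℤ} {c : Coeff} (hc : c ∈ coeffPiece k) : etaL c ∈ dualPiece k := by
  have h := monomial_mem hc 0
  rw [map_zero, add_zero] at h
  convert h using 1
  exact (mul_one _).symm.trans (congrArg (etaL c * ·) (map_one Dual.mk).symm)

instance : SetLike.GradedMonoid dualPiece where
  one_mem := by rw [← map_one etaL]; exact etaL_mem coeffPiece_one
  mul_mem _ _ _ _ hx hy := dualPiece_mul hx hy

theorem gen_mem (i : ℕ ⊕ ℕ) : Dual.mk (MvPolynomial.X i) ∈ dualPiece (genWeight i) := by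
  have h := monomial_mem coeffPiece_one (Finsupp.single i 1)
  rw [Finsupp.weight_single, zero_add, one_smul, map_one, one_mul] at h
  exact h

theorem dTau_mem (n : ℕ) : dTau n ∈ dualPiece (2 ^ (n + 1) - 1, 2 ^ n - 1) := gen_mem (Sum.inl n)

theorem dXi_mem (n : ℕ) : dXi n ∈ dualPiece (2 ^ (n + 1) - 2, 2 ^ n - 1) := by
  cases n with
  | zero =>
    exact mem_of_eq dualPiece (SetLike.GradedOne.one_mem : (1 : Dual) ∈ dualPiece 0)
      (by ext <;> simp)
  | succ n => exact gen_mem (Sum.inr n)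

theorem etaR_mem {k : ℤ × ℤ} {c : Coeff} (hc : c ∈ coeffPiece k) : etaR c ∈ dualPiece k := by
  rw [c.as_sum, map_sum]
  refine sum_mem fun m hm => ?_
  have hk : Finsupp.weight coeffWeight m = k := hc (MvPolynomial.mem_support_iff.mp hm)
  have ht : etaL cTau + etaL cRho * dTau 0 ∈ dualPiece (0, -1) :=
    add_mem (etaL_mem cTau_mem)
      (mem_of_eq dualPiece (dualPiece_mul (etaL_mem cRho_mem) (dTau_mem 0)) (by simp))
  have h : etaR (MvPolynomial.monomial m (MvPolynomial.coeff m c)) =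
      etaL (MvPolynomial.C (MvPolynomial.coeff m c)) *
        ((etaL cTau + etaL cRho * dTau 0) ^ m 0 * etaL cRho ^ m 1) := by
    simp [etaR, MvPolynomial.eval₂_monomial, Finsupp.prod_fintype]
  rw [h]
  refine mem_of_eq dualPiece (dualPiece_mul (etaL_mem (C_mem _)) (dualPiece_mul
    (SetLike.pow_mem_graded (m 0) ht) (SetLike.pow_mem_graded (m 1) (etaL_mem cRho_mem)))) ?_
  rw [← hk, Finsupp.weight_apply, Finsupp.sum_fintype _ _ (by simp)]
  ext <;> simp [coeffWeight]

/-- The homogeneous elements of `A ⊗ A`. -/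
def dual2Piece (d : ℤ × ℤ) : AddSubgroup Dual2 :=
  AddSubgroup.closure {z | ∃ (k l : ℤ × ℤ) (x y : Dual), x ∈ dualPiece k ∧ y ∈ dualPiece l ∧
    k + l = d ∧ z = inL x * inR y}

theorem tmul_mem {k l : ℤ × ℤ} {x y : Dual} (hx : x ∈ dualPiece k) (hy : y ∈ dualPiece l) :
    inL x * inR y ∈ dual2Piece (k + l) :=
  AddSubgroup.subset_closure ⟨k, l, x, y, hx, hy, rfl, rfl⟩

theorem inL_mem {k : ℤ × ℤ} {x : Dual} (hx : x ∈ dualPiece k) : inL x ∈ dual2Piece k := by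
  simpa using tmul_mem hx (SetLike.GradedOne.one_mem : (1 : Dual) ∈ dualPiece 0)

instance : SetLike.GradedMonoid dual2Piece where
  one_mem := by rw [← map_one inL]; exact inL_mem SetLike.GradedOne.one_mem
  mul_mem k l x y hx hy := by
    refine closure_mul_mem ?_ hx hy
    rintro _ ⟨k₁, l₁, x₁, y₁, hx₁, hy₁, rfl, rfl⟩ _ ⟨k₂, l₂, x₂, y₂, hx₂, hy₂, rfl, rfl⟩
    have := tmul_mem (dualPiece_mul hx₁ hx₂) (dualPiece_mul hy₁ hy₂)
    rw [map_mul, map_mul, mul_mul_mul_comm] at this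
    exact mem_of_eq dual2Piece this (by abel)

theorem comulTau_mem (n : ℕ) : comulTau n ∈ dual2Piece (2 ^ (n + 1) - 1, 2 ^ n - 1) := by
  refine add_mem (inL_mem (dTau_mem n)) (sum_mem fun i hi => ?_)
  refine mem_of_eq dual2Piece
    (tmul_mem (SetLike.pow_mem_graded (2 ^ i) (dXi_mem (n - i))) (dTau_mem i)) ?_
  obtain ⟨j, rfl⟩ : ∃ j, n = i + j := ⟨n - i, by have := Finset.mem_range.mp hi; omega⟩
  rw [Nat.add_sub_cancel_left]
  ext <;> simp <;> ring

theorem comulXi_mem (n : ℕ) : comulXi n ∈ dual2Piece (2 ^ (n + 1) - 2, 2 ^ n - 1) := by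
  refine sum_mem fun i hi => ?_
  refine mem_of_eq dual2Piece
    (tmul_mem (SetLike.pow_mem_graded (2 ^ i) (dXi_mem (n - i))) (dXi_mem i)) ?_
  obtain ⟨j, rfl⟩ : ∃ j, n = i + j := ⟨n - i, by have := Finset.mem_range.mp hi; omega⟩
  rw [Nat.add_sub_cancel_left]
  ext <;> simp <;> ring

theorem mk_monomial (e : ℕ ⊕ ℕ →₀ ℕ) : Dual.mk (MvPolynomial.monomial e 1) =
    ∏ i ∈ e.support, Dual.mk (MvPolynomial.X i) ^ e i := by
  rw [MvPolynomial.monomial_eq, map_one, one_mul, Finsupp.prod, map_prod]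
  simp

theorem weight_eq (e : ℕ ⊕ ℕ →₀ ℕ) :
    Finsupp.weight genWeight e = ∑ i ∈ e.support, e i • genWeight i := by
  rw [Finsupp.weight_apply, Finsupp.sum]

theorem comul_mem {k : ℤ × ℤ} {x : Dual} (hx : x ∈ dualPiece k) : comul x ∈ dual2Piece k := by
  induction hx using AddSubgroup.closure_induction with
  | mem x hx =>
    obtain ⟨k, c, e, hc, rfl, rfl⟩ := hx
    rw [smul_eq_etaL_mul, map_mul, comul_etaL, mk_monomial, map_prod, weight_eq]
    refine SetLike.GradedMul.mul_mem (inL_mem (etaL_mem hc))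
      (SetLike.prod_mem_graded _ _ _ fun i _ => ?_)
    rw [map_pow]
    refine SetLike.pow_mem_graded _ ?_
    rcases i with n | n
    · exact mem_of_eq dual2Piece ((comul_dTau n).symm ▸ comulTau_mem n) rfl
    · exact mem_of_eq dual2Piece ((comul_dXi (n + 1)).symm ▸ comulXi_mem (n + 1)) rfl
  | zero => simp
  | add x y _ _ h1 h2 => rw [map_add]; exact add_mem h1 h2
  | neg x _ h => rw [map_neg]; exact neg_mem h

theorem cap_mem {k d : ℤ × ℤ} {φ : Functional} (hφ : φ ∈ functionalPiece d) {x : Dual}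
    (hx : x ∈ dualPiece k) : cap φ.eval x ∈ dualPiece (k - d) := by
  have h : ∀ z ∈ dual2Piece k, contract φ.eval z ∈ dualPiece (k - d) := by
    intro z hz
    induction hz using AddSubgroup.closure_induction with
    | mem z hz =>
      obtain ⟨k, l, x, y, hx', hy', rfl, rfl⟩ := hz
      rw [contract_tmul, add_sub_assoc]
      exact dualPiece_mul hx' (etaR_mem (hφ l y hy'))
    | zero => simp
    | add x y _ _ h1 h2 => rw [map_add]; exact add_mem h1 h2
    | neg x _ h => rw [map_neg]; exact neg_mem h
  exact h _ (comul_mem hx)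

theorem counit_mem {k : ℤ × ℤ} {x : Dual} (hx : x ∈ dualPiece k) : counit x ∈ coeffPiece k := by
  induction hx using AddSubgroup.closure_induction with
  | mem x hx =>
    obtain ⟨k, c, e, hc, rfl, rfl⟩ := hx
    rw [smul_eq_etaL_mul, map_mul, counit_etaL, mk_monomial, map_prod]
    rcases Finset.eq_empty_or_nonempty e.support with he | ⟨i, hi⟩
    · rw [Finsupp.support_eq_empty.mp he]; simpa using hc
    · rw [Finset.prod_eq_zero hi, mul_zero]
      · exact zero_mem _
      · rw [map_pow]
        have : counit (Dual.mk (MvPolynomial.X i)) = 0 := by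
          rcases i with n | n
          · exact counit_dTau n
          · exact counit_dXi (n + 1)
        rw [this, zero_pow (Finsupp.mem_support_iff.mp hi)]
  | zero => simp
  | add x y _ _ h1 h2 => rw [map_add]; exact add_mem h1 h2
  | neg x _ h => rw [map_neg]; exact neg_mem h

instance : SetLike.GradedMonoid functionalPiece where
  one_mem k x hx := by rw [sub_zero]; exact counit_mem hx
  mul_mem d₁ d₂ φ ψ hφ hψ k x hx := by
    have := hφ _ _ (cap_mem hψ hx)
    rwa [sub_sub, add_comm d₂ d₁] at this

theorem smul_mem_functionalPiece {k d : ℤ × ℤ} {c : Coeff} {φ : Functional}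
    (hc : c ∈ coeffPiece k) (hφ : φ ∈ functionalPiece d) : c • φ ∈ functionalPiece (d - k) := by
  intro l x hx
  have := coeffPiece_mul hc (hφ l x hx)
  rwa [show k + (l - d) = l - (d - k) by abel] at this

/-! ### The motivic Steenrod algebra over `ℝ` -/

/-- The motivic Steenrod algebra over `ℝ`: the graded dual of the dual Steenrod algebra, that is
the ring of finite sums of homogeneous functionals. -/
def Steenrod : Subring Functional where
  carrier := {φ | φ ∈ ⨆ d, functionalPiece d}
  zero_mem' := zero_mem (⨆ d, functionalPiece d)
  one_mem' := AddSubgroup.mem_iSup_of_mem 0 SetLike.GradedOne.one_mem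
  add_mem' hx hy := (⨆ d, functionalPiece d).add_mem hx hy
  neg_mem' hx := (⨆ d, functionalPiece d).neg_mem hx
  mul_mem' {a b} ha hb := by
    change a * b ∈ ⨆ d, functionalPiece d
    induction ha using AddSubgroup.iSup_induction' with
    | hp d a ha =>
      induction hb using AddSubgroup.iSup_induction' with
      | hp d' b hb => exact AddSubgroup.mem_iSup_of_mem (d + d') (SetLike.GradedMul.mul_mem ha hb)
      | h1 => rw [mul_zero]; exact zero_mem _
      | hadd x y _ _ hx hy => rw [mul_add]; exact add_mem hx hy
    | h1 => rw [zero_mul]; exact zero_mem _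
    | hadd x y _ _ hx hy => rw [add_mul]; exact add_mem hx hy

/-- The elements of cohomological bidegree `d` of the motivic Steenrod algebra. -/
def Steenrod.piece (d : ℤ × ℤ) : AddSubgroup Steenrod :=
  (functionalPiece d).comap Steenrod.subtype.toAddMonoidHom

def Steenrod.ofPiece {d : ℤ × ℤ} (φ : Functional) (h : φ ∈ functionalPiece d) : Steenrod :=
  ⟨φ, (AddSubgroup.mem_iSup_of_mem d h : φ ∈ ⨆ d, functionalPiece d)⟩

/-- The element `τ`, of cohomological bidegree `(0, 1)`. -/
def Steenrod.tau : Steenrod :=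
  Steenrod.ofPiece (cTau • 1) (smul_mem_functionalPiece cTau_mem SetLike.GradedOne.one_mem)

/-- The element `ρ`, of cohomological bidegree `(1, 1)`. -/
def Steenrod.rho : Steenrod :=
  Steenrod.ofPiece (cRho • 1) (smul_mem_functionalPiece cRho_mem SetLike.GradedOne.one_mem)

/-- The quotient `𝔽₂[τ, ρ][τ₀, ξ₁] / (τ₀² = τ ξ₁ + ρ ξ₁ τ₀)` of the dual Steenrod algebra, which is
free over `𝔽₂[τ, ρ]` on the monomials `ξ₁ⁿ` and `τ₀ ξ₁ⁿ`. -/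
abbrev SmallDual : Type :=
  QuadraticAlgebra (Polynomial Coeff) (Polynomial.C cTau * Polynomial.X)
    (Polynomial.C cRho * Polynomial.X)

/-- The projection: all monomials `∏ τᵢ^eᵢ ∏ ξⱼ^rⱼ`, `eᵢ ∈ {0, 1}`, of the monomial basis
other than `ξ₁ⁿ` and `τ₀ ξ₁ⁿ` go to `0`. -/
def toSmallDual : Dual →+* SmallDual :=
  Dual.lift ((algebraMap (Polynomial Coeff) SmallDual).comp Polynomial.C)
    (fun n => if n = 0 then QuadraticAlgebra.omega else 0)
    (fun n => if n = 0 then algebraMap (Polynomial Coeff) SmallDual Polynomial.X else 0)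
    (by
      intro n
      cases n with
      | zero => ext <;> simp [pow_two]
      | succ n => simp)

/-- The functional dual to `ξ₁^k` (if `n = 2k`) or to `τ₀ ξ₁^k` (if `n = 2k + 1`) in the monomial
basis of the dual Steenrod algebra. -/
def sqFunctional (n : ℕ) : Functional :=
  { toFun := fun x => if Even n then (toSmallDual x).re.coeff (n / 2)
      else (toSmallDual x).im.coeff (n / 2)
    map_add' := fun x y => by split_ifs <;> simp
    map_smul' := fun c x => by
      have h : toSmallDual (etaL c) = algebraMap (Polynomial Coeff) SmallDual (Polynomial.C c) := by
        simp [toSmallDual]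
      rw [smul_eq_etaL_mul, map_mul, h]
      split_ifs <;> simp : Dual →ₗ[Coeff] Coeff }

def polyPiece (d : ℤ × ℤ) : AddSubgroup (Polynomial Coeff) where
  carrier := {p | ∀ i, p.coeff i ∈ coeffPiece (d - i • (2, 1))}
  zero_mem' i := by simp
  add_mem' hp hq i := by rw [Polynomial.coeff_add]; exact add_mem (hp i) (hq i)
  neg_mem' hp i := by rw [Polynomial.coeff_neg]; exact neg_mem (hp i)

theorem polyPiece_mul {k l : ℤ × ℤ} {p q : Polynomial Coeff} (hp : p ∈ polyPiece k)
    (hq : q ∈ polyPiece l) : p * q ∈ polyPiece (k + l) := by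
  intro i
  rw [Polynomial.coeff_mul]
  refine sum_mem fun a ha => ?_
  refine mem_of_eq coeffPiece (coeffPiece_mul (hp a.1) (hq a.2)) ?_
  rw [← Finset.HasAntidiagonal.mem_antidiagonal.mp ha, add_smul]; abel

theorem polyPiece_C {k : ℤ × ℤ} {c : Coeff} (hc : c ∈ coeffPiece k) :
    Polynomial.C c ∈ polyPiece k := by
  intro i
  rw [Polynomial.coeff_C]
  split_ifs with h
  · subst h; simpa using hc
  · exact zero_mem _

theorem polyPiece_X : (Polynomial.X : Polynomial Coeff) ∈ polyPiece (2, 1) := by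
  intro i
  rw [Polynomial.coeff_X]
  split_ifs with h
  · subst h; simpa using coeffPiece_one
  · exact zero_mem _

def smallPiece (d : ℤ × ℤ) : AddSubgroup SmallDual where
  carrier := {b | b.re ∈ polyPiece d ∧ b.im ∈ polyPiece (d - (1, 0))}
  zero_mem' := ⟨zero_mem _, zero_mem _⟩
  add_mem' hp hq := ⟨add_mem hp.1 hq.1, add_mem hp.2 hq.2⟩
  neg_mem' hp := ⟨neg_mem hp.1, neg_mem hp.2⟩

instance : SetLike.GradedMonoid smallPiece where
  one_mem := ⟨polyPiece_C coeffPiece_one, zero_mem _⟩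
  mul_mem k l x y hx hy := by
    have ht := polyPiece_mul (polyPiece_C cTau_mem) polyPiece_X
    have hr := polyPiece_mul (polyPiece_C cRho_mem) polyPiece_X
    refine ⟨?_, ?_⟩
    · rw [QuadraticAlgebra.re_mul]
      refine add_mem (polyPiece_mul hx.1 hy.1)
        (mem_of_eq polyPiece (polyPiece_mul (polyPiece_mul ht hx.2) hy.2) ?_)
      ext <;> simp
      all_goals ring
    · rw [QuadraticAlgebra.im_mul]
      refine add_mem (add_mem (mem_of_eq polyPiece (polyPiece_mul hx.1 hy.2) ?_)
        (mem_of_eq polyPiece (polyPiece_mul hx.2 hy.1) ?_))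
        (mem_of_eq polyPiece (polyPiece_mul (polyPiece_mul hr hx.2) hy.2) ?_)
      · abel
      · abel
      · ext <;> simp
        all_goals ring

theorem toSmallDual_mem {k : ℤ × ℤ} {x : Dual} (hx : x ∈ dualPiece k) :
    toSmallDual x ∈ smallPiece k := by
  induction hx using AddSubgroup.closure_induction with
  | mem x hx =>
    obtain ⟨k, c, e, hc, rfl, rfl⟩ := hx
    rw [smul_eq_etaL_mul, map_mul, mk_monomial, map_prod, weight_eq]
    refine SetLike.GradedMul.mul_mem ?_ (SetLike.prod_mem_graded _ _ _ fun i _ => ?_)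
    · have h : toSmallDual (etaL c) =
          algebraMap (Polynomial Coeff) SmallDual (Polynomial.C c) := by simp [toSmallDual]
      rw [h]
      exact ⟨polyPiece_C hc, zero_mem _⟩
    · rw [map_pow]
      refine SetLike.pow_mem_graded _ ?_
      rcases i with n | n
      · have h : toSmallDual (Dual.mk (MvPolynomial.X (Sum.inl n))) =
            if n = 0 then QuadraticAlgebra.omega else 0 := Dual.lift_dTau _ _ _ _ n
        rw [h]
        split_ifs with hn
        · subst hn
          exact ⟨zero_mem _, mem_of_eq polyPiece (polyPiece_C coeffPiece_one)
            (by simp [genWeight])⟩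
        · exact zero_mem _
      · have h : toSmallDual (Dual.mk (MvPolynomial.X (Sum.inr n))) =
            if n = 0 then algebraMap (Polynomial Coeff) SmallDual Polynomial.X else 0 :=
          Dual.lift_dXi _ _ _ _ n
        rw [h]
        split_ifs with hn
        · subst hn
          exact ⟨mem_of_eq polyPiece polyPiece_X (by norm_num [genWeight]), zero_mem _⟩
        · exact zero_mem _
  | zero => simp
  | add x y _ _ h1 h2 => rw [map_add]; exact add_mem h1 h2
  | neg x _ h => rw [map_neg]; exact neg_mem h

theorem sqFunctional_mem (n : ℕ) :
    sqFunctional n ∈ functionalPiece ((n : ℤ), ((n / 2 : ℕ) : ℤ)) := by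
  intro k x hx
  obtain ⟨h1, h2⟩ := toSmallDual_mem hx
  change (if Even n then (toSmallDual x).re.coeff (n / 2)
    else (toSmallDual x).im.coeff (n / 2)) ∈ _
  split_ifs with hn
  · refine mem_of_eq coeffPiece (h1 (n / 2)) ?_
    obtain ⟨m, rfl⟩ := hn
    have : (m + m) / 2 = m := by omega
    rw [this]
    ext <;> simp
    all_goals ring
  · refine mem_of_eq coeffPiece (h2 (n / 2)) ?_
    obtain ⟨m, rfl⟩ := Nat.not_even_iff_odd.mp hn
    have : (2 * m + 1) / 2 = m := by omega
    rw [this]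
    ext <;> simp
    all_goals ring

/-- The motivic Steenrod square `Sqⁿ`, of cohomological bidegree `(n, ⌊n/2⌋)`. -/
def Steenrod.Sq (n : ℕ) : Steenrod := Steenrod.ofPiece (sqFunctional n) (sqFunctional_mem n)

end RMotivic

end

noncomputable section

namespace RMotivic

/-! ### Homogeneous coefficients -/

/-! The involution is pinned down by bidegrees together with the failure of `τ` to be central.

In bidegree `(0, 1)` the algebra consists of `0` and `τ`, in bidegree `(1, 0)` of `0` and `Sq¹`
(`eq_zero_or_eq_tau`, `eq_zero_or_eq_sq_one`). An involution is injective, so `χ` fixes `τ` and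
`Sq¹`. Applying `χ` to `Sq¹ τ = τ Sq¹ + ρ` then forces `χ(ρ) = ρ`.

Right multiplication by `τ` is precomposition with multiplication by `η_R(τ) = τ + ρ τ₀`, so every
functional satisfies `φ τ = τ φ + ρ φ(τ₀ · -)` (`eval_mul_tau`). Applying `χ` to the commutation
relations of `Sq²` and `Sq⁴` with `τ`, where the terms other than `χ(Sq²)`, `χ(Sq⁴)` are already
known, computes the commutators of `χ(Sq²)` and `χ(Sq⁴)` with `τ`. Cancelling `ρ` gives the
functionals `x ↦ φ(τ₀ x)` (`eval_tau0_mul_of_mul_tau`).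

These determine `φ` itself. A functional of topological degree at most `4` is known from its values
on seven monomials (`functional_ext_low`). Degree reasons kill some of the values. Those on
multiples of `τ₀` are given directly, and the others follow by taking `x` to be a multiple of `τ₀`,
because `τ₀² = τ ξ₁ + ρ τ₀ ξ₁ + ρ τ₁` and the coefficient ring is a domain (`eq_of_commutator_two`,
`eq_of_commutator_four`). -/

theorem coeffPiece_eq_zero {k : ℤ × ℤ} {c : Coeff} (hc : c ∈ coeffPiece k)
    (hk : 0 < k.1 ∨ k.1 < k.2) : c = 0 := by
  by_contra h
  obtain ⟨m, hm⟩ := MvPolynomial.ne_zero_iff.mp h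
  have hw : Finsupp.weight coeffWeight m = k := hc hm
  -- The monomial `τ^a ρ^b` has bidegree `(-b, -a - b)`, so a nonzero coefficient forces `k.2 ≤ k.1
  -- ≤ 0`.
  rw [Finsupp.weight_apply, Finsupp.sum_fintype _ _ (by simp)] at hw
  simp only [Fin.sum_univ_two, coeffWeight] at hw
  have h1 := congrArg Prod.fst hw
  have h2 := congrArg Prod.snd hw
  simp at h1 h2
  omega

/-- The bidegrees of `τ` and `ρ` are linearly independent, so a bidegree contains at most one
monomial, and its coefficient lies in `𝔽₂`. -/
theorem coeffPiece_eq_zero_or {k : ℤ × ℤ} {c : Coeff} (hc : c ∈ coeffPiece k) (a b : ℕ)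
    (hk : k = (-(b : ℤ), -(a : ℤ) - b)) : c = 0 ∨ c = cTau ^ a * cRho ^ b := by
  have hm : ∀ m : Fin 2 →₀ ℕ, MvPolynomial.coeff m c ≠ 0 →
      m = Finsupp.single 0 a + Finsupp.single 1 b := by
    intro m hm
    have hw : Finsupp.weight coeffWeight m = k := hc hm
    rw [Finsupp.weight_apply, Finsupp.sum_fintype _ _ (by simp)] at hw
    simp only [Fin.sum_univ_two, coeffWeight, hk] at hw
    have h1 := congrArg Prod.fst hw
    have h2 := congrArg Prod.snd hw
    simp at h1 h2
    ext i
    fin_cases i <;> simp <;> omega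
  have hX : cTau ^ a * cRho ^ b =
      MvPolynomial.monomial (Finsupp.single 0 a + Finsupp.single 1 b) (1 : ZMod 2) := by
    rw [MvPolynomial.X_pow_eq_monomial, MvPolynomial.X_pow_eq_monomial,
      MvPolynomial.monomial_mul, one_mul]
  have hc' : c = MvPolynomial.monomial (Finsupp.single 0 a + Finsupp.single 1 b)
      (MvPolynomial.coeff (Finsupp.single 0 a + Finsupp.single 1 b) c) := by
    ext m
    rw [MvPolynomial.coeff_monomial]
    split_ifs with h
    · rw [h]
    · by_contra h'
      exact h (hm m h').symm
  have h01 : ∀ r : ZMod 2, r = 0 ∨ r = 1 := by decide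
  rcases h01 (MvPolynomial.coeff (Finsupp.single 0 a + Finsupp.single 1 b) c) with h | h
  · left; rw [hc', h, map_zero]
  · right; rw [hX, ← h]; exact hc'

theorem functionalPiece_eval_eq_zero {d k : ℤ × ℤ} {φ : Functional} (hφ : φ ∈ functionalPiece d)
    {x : Dual} (hx : x ∈ dualPiece k) (hk : d.1 < k.1 ∨ k.1 - d.1 < k.2 - d.2) :
    φ.eval x = 0 :=
  coeffPiece_eq_zero (hφ k x hx) (by simpa using hk)

/-! ### Low degrees of the dual Steenrod algebra -/

/-- The monomials `∏ τᵢ^eᵢ ∏ ξⱼ^rⱼ` with `eᵢ ∈ {0, 1}` of topological degree at most `4`. -/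
def lowMonomials : Set Dual :=
  {1, dTau 0, dXi 1, dTau 0 * dXi 1, dTau 1, dXi 1 ^ 2, dTau 0 * dTau 1}

def highSet : Set Dual := {x | ∃ k : ℤ × ℤ, 5 ≤ k.1 ∧ x ∈ dualPiece k}

theorem gen_fst_nonneg (i : ℕ ⊕ ℕ) : 0 ≤ (genWeight i).1 := by
  rcases i with n | n
  · have : (1 : ℤ) ≤ 2 ^ (n + 1) := one_le_pow₀ (by norm_num)
    simp [genWeight]; omega
  · have : (1 : ℤ) ≤ 2 ^ n := one_le_pow₀ (by norm_num)
    simp [genWeight]; rw [pow_add]; omega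

/-- The factor `x` is carried along so that the relation for `τ₀²` also rewrites inside longer
monomials such as `τ₀ (τ₀ ξ₁)`. -/
theorem tau0_sq_mul (x : Dual) : dTau 0 * (dTau 0 * x) =
    etaL cTau * (dXi 1 * x) + etaL cRho * (dTau 0 * (dXi 1 * x)) + etaL cRho * (dTau 1 * x) := by
  have := dTau_sq 0
  linear_combination x * this

/-- Generators other than `τ₀`, `ξ₁`, `τ₁` have degree at least `6`. A product of one of these three
with a low monomial is again low or has degree at least `5`, except for `τ₀ · τ₀` and `τ₀ · τ₀ ξ₁`,
where the relation for `τ₀²` is applied. -/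
theorem gen_mul_mem_span (i : ℕ ⊕ ℕ) {x : Dual}
    (hx : x ∈ Submodule.span Coeff (lowMonomials ∪ highSet)) :
    Dual.mk (MvPolynomial.X i) * x ∈ Submodule.span Coeff (lowMonomials ∪ highSet) := by
  have low : ∀ {y}, y ∈ lowMonomials → y ∈ Submodule.span Coeff (lowMonomials ∪ highSet) :=
    fun h => Submodule.subset_span (Or.inl h)
  have high : ∀ {y} (k : ℤ × ℤ), y ∈ dualPiece k → 5 ≤ k.1 →
      y ∈ Submodule.span Coeff (lowMonomials ∪ highSet) :=
    fun k h h' => Submodule.subset_span (Or.inr ⟨k, h', h⟩)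
  have t0 := dTau_mem 0
  have t1 := dTau_mem 1
  have x1 := dXi_mem 1
  induction hx using Submodule.span_induction with
  | zero => rw [mul_zero]; exact zero_mem _
  | add x y _ _ h1 h2 => rw [mul_add]; exact add_mem h1 h2
  | smul c x _ h => rw [mul_smul_comm]; exact Submodule.smul_mem _ c h
  | mem x hx =>
    rcases hx with hx | ⟨k, hk, hx⟩
    swap
    · exact high _ (dualPiece_mul (gen_mem i) hx) (by
        have := gen_fst_nonneg i
        simp only [Prod.fst_add]; omega)
    have hcases : (Dual.mk (MvPolynomial.X i) = dTau 0 ∨ Dual.mk (MvPolynomial.X i) = dXi 1 ∨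
        Dual.mk (MvPolynomial.X i) = dTau 1) ∨ 5 ≤ (genWeight i).1 := by
      rcases i with (_ | _ | n) | (_ | n)
      · exact .inl (.inl rfl)
      · exact .inl (.inr (.inr rfl))
      · right
        have : (1 : ℤ) ≤ 2 ^ n := one_le_pow₀ (by norm_num)
        simp [genWeight, pow_succ]; omega
      · exact .inl (.inr (.inl rfl))
      · right
        have : (1 : ℤ) ≤ 2 ^ n := one_le_pow₀ (by norm_num)
        simp [genWeight, pow_succ]; omega
    have hxdeg : ∃ k : ℤ × ℤ, 0 ≤ k.1 ∧ x ∈ dualPiece k := by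
      rcases hx with rfl | rfl | rfl | rfl | rfl | rfl | rfl
      · exact ⟨0, le_rfl, SetLike.GradedOne.one_mem⟩
      · exact ⟨_, by norm_num, t0⟩
      · exact ⟨_, by norm_num, x1⟩
      · exact ⟨_, by norm_num, dualPiece_mul t0 x1⟩
      · exact ⟨_, by norm_num, t1⟩
      · exact ⟨_, by norm_num, SetLike.pow_mem_graded 2 x1⟩
      · exact ⟨_, by norm_num, dualPiece_mul t0 t1⟩
    rcases hcases with hi | hi
    swap
    · obtain ⟨k, hk, hx⟩ := hxdeg
      exact high _ (dualPiece_mul (gen_mem i) hx) (by simp only [Prod.fst_add]; omega)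
    have mem : ∀ {y}, y ∈ Submodule.span Coeff (lowMonomials ∪ highSet) → ∀ c : Coeff,
        etaL c * y ∈ Submodule.span Coeff (lowMonomials ∪ highSet) := fun h c => by
      rw [← smul_eq_etaL_mul]; exact Submodule.smul_mem _ c h
    rcases hi with hi | hi | hi <;> rw [hi]
    · rcases hx with rfl | rfl | rfl | rfl | rfl | rfl | rfl
      · exact low (by simp [lowMonomials])
      · have := tau0_sq_mul 1
        simp only [mul_one] at this
        rw [this]
        exact add_mem (add_mem (mem (low (by simp [lowMonomials])) _)
          (mem (low (by simp [lowMonomials])) _)) (mem (low (by simp [lowMonomials])) _)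
      · exact low (by simp [lowMonomials])
      · rw [tau0_sq_mul, ← pow_two]
        exact add_mem (add_mem (mem (low (by simp [lowMonomials])) _)
          (mem (high _ (dualPiece_mul t0 (SetLike.pow_mem_graded 2 x1)) (by norm_num)) _))
          (mem (high _ (dualPiece_mul t1 x1) (by norm_num)) _)
      · exact low (by simp [lowMonomials])
      · exact high _ (dualPiece_mul t0 (SetLike.pow_mem_graded 2 x1)) (by norm_num)
      · exact high _ (dualPiece_mul t0 (dualPiece_mul t0 t1)) (by norm_num)
    · rcases hx with rfl | rfl | rfl | rfl | rfl | rfl | rfl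
      · exact low (by simp [lowMonomials])
      · rw [mul_comm]; exact low (by simp [lowMonomials])
      · rw [← pow_two]; exact low (by simp [lowMonomials])
      · exact high _ (dualPiece_mul x1 (dualPiece_mul t0 x1)) (by norm_num)
      · exact high _ (dualPiece_mul x1 t1) (by norm_num)
      · exact high _ (dualPiece_mul x1 (SetLike.pow_mem_graded 2 x1)) (by norm_num)
      · exact high _ (dualPiece_mul x1 (dualPiece_mul t0 t1)) (by norm_num)
    · rcases hx with rfl | rfl | rfl | rfl | rfl | rfl | rfl
      · exact low (by simp [lowMonomials])
      · rw [mul_comm]; exact low (by simp [lowMonomials])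
      · exact high _ (dualPiece_mul t1 x1) (by norm_num)
      · exact high _ (dualPiece_mul t1 (dualPiece_mul t0 x1)) (by norm_num)
      · exact high _ (dualPiece_mul t1 t1) (by norm_num)
      · exact high _ (dualPiece_mul t1 (SetLike.pow_mem_graded 2 x1)) (by norm_num)
      · exact high _ (dualPiece_mul t1 (dualPiece_mul t0 t1)) (by norm_num)

/-- Only spanning is needed, not linear independence: the span contains `1` and is stable under
multiplication by generators. -/
theorem span_low_high : Submodule.span Coeff (lowMonomials ∪ highSet) = ⊤ := by
  rw [eq_top_iff]
  rintro x -
  obtain ⟨p, rfl⟩ : ∃ p, Dual.mk p = x := Ideal.Quotient.mk_surjective x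
  induction p using MvPolynomial.induction_on with
  | C c =>
    have : Dual.mk (MvPolynomial.C c) = c • (1 : Dual) := by
      rw [smul_eq_etaL_mul, mul_one]; exact Dual.mk.commutes c
    rw [this]
    exact Submodule.smul_mem _ c (Submodule.subset_span (Or.inl (by simp [lowMonomials])))
  | add p q hp hq => rw [map_add]; exact add_mem hp hq
  | mul_X p i hp => rw [map_mul, mul_comm]; exact gen_mul_mem_span i hp

/-- A homogeneous functional of topological degree at most `4` is determined by its values on the
monomials of topological degree at most `4`. -/
theorem functional_ext_low {d : ℤ × ℤ} (hd : d.1 ≤ 4) {φ ψ : Functional}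
    (hφ : φ ∈ functionalPiece d) (hψ : ψ ∈ functionalPiece d)
    (h : ∀ x ∈ lowMonomials, φ.eval x = ψ.eval x) : φ = ψ := by
  refine LinearMap.ext_on span_low_high ?_
  rintro x (hx | ⟨k, hk, hx⟩)
  · exact h x hx
  · exact (functionalPiece_eval_eq_zero hφ hx (Or.inl (by omega))).trans
      (functionalPiece_eval_eq_zero hψ hx (Or.inl (by omega))).symm

/-! ### Products of functionals -/

theorem eval_etaL_mul (φ : Functional) (c : Coeff) (x : Dual) :
    φ.eval (etaL c * x) = c * φ.eval x := by
  rw [← smul_eq_etaL_mul, map_smul, smul_eq_mul]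

theorem eval_tau0_sq_mul (φ : Functional) (x : Dual) : φ.eval (dTau 0 * (dTau 0 * x)) =
    cTau * φ.eval (dXi 1 * x) + cRho * φ.eval (dTau 0 * (dXi 1 * x))
      + cRho * φ.eval (dTau 1 * x) := by
  rw [tau0_sq_mul, map_add, map_add, eval_etaL_mul, eval_etaL_mul, eval_etaL_mul]

theorem eval_add (φ ψ : Functional) (x : Dual) : (φ + ψ).eval x = φ.eval x + ψ.eval x := rfl

theorem eval_smul (c : Coeff) (φ : Functional) (x : Dual) :
    (c • φ).eval x = c * φ.eval x := rfl

theorem eval_one (x : Dual) : (1 : Functional).eval x = counit x := rfl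

/-- Contracting against `c` times the counit gives `∑ x' η_R(c ε(x''))`, and `η_R(c)` factors out.
Thus right multiplication by a coefficient acts through the right unit, while left multiplication
acts through the left unit. -/
theorem cap_smul_one (c : Coeff) (x : Dual) :
    cap (c • (1 : Functional)).eval x = x * etaR c := by
  have h : ∀ z : Dual2, contract (c • (1 : Functional)).eval z =
      contract counitL z * etaR c := by
    intro z
    induction z using Dual2.induction with
    | h a b =>
      rw [contract_tmul, contract_tmul, eval_smul, map_mul, mul_comm (etaR c), mul_assoc]
      rfl
    | hadd x y hx hy => rw [map_add, map_add, hx, hy, add_mul]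
  rw [cap_apply, h, ← cap_apply, cap_counitL]

/-- The second summand measures how far `φ` is from commuting with `τ`; it comes from the term `ρ
τ₀` of `η_R(τ)`. -/
theorem eval_mul_tau (φ : Functional) (x : Dual) : (φ * cTau • (1 : Functional)).eval x =
    cTau * φ.eval x + cRho * φ.eval (dTau 0 * x) := by
  rw [Functional.eval_mul, cap_smul_one, etaR_cTau, mul_add, map_add, mul_comm x, eval_etaL_mul,
    mul_comm x, mul_assoc, eval_etaL_mul]

/-- The left and right units agree on `ρ`, hence `ρ` is central. -/
theorem functional_mul_rho (φ : Functional) : φ * cRho • (1 : Functional) = cRho • φ := by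
  ext1 x
  rw [Functional.eval_mul, cap_smul_one, etaR_cRho, mul_comm x, eval_etaL_mul, eval_smul]

/-! ### The operators `cap ψ` on the low monomials -/

section cap

variable (ψ : Dual →ₗ[Coeff] Coeff)

theorem contract_inL (a : Dual) : contract ψ (inL a) = a * etaR (ψ 1) := by
  rw [← contract_tmul, map_one, mul_one]

theorem contract_inR (b : Dual) : contract ψ (inR b) = etaR (ψ b) := by
  rw [← one_mul (inR b), ← map_one inL, contract_tmul, one_mul]

theorem comul_tau0 : comul (dTau 0) = inL (dTau 0) + inR (dTau 0) := by simp [comulTau, dXi]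

theorem comul_xi1 : comul (dXi 1) = inL (dXi 1) + inR (dXi 1) := by
  rw [comul_dXi, comulXi, Finset.sum_range_succ, Finset.sum_range_one]
  simp [dXi]

theorem comul_tau1 : comul (dTau 1) =
    inL (dTau 1) + inL (dXi 1) * inR (dTau 0) + inR (dTau 1) := by
  simp [comulTau, Finset.sum_range_succ, dXi]; ring

theorem cap_one : cap ψ 1 = etaR (ψ 1) := by
  rw [cap_apply, map_one, ← map_one inL, contract_inL, one_mul]

theorem cap_tau0 : cap ψ (dTau 0) = dTau 0 * etaR (ψ 1) + etaR (ψ (dTau 0)) := by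
  rw [cap_apply, comul_tau0, map_add, contract_inL, contract_inR]

theorem cap_xi1 : cap ψ (dXi 1) = dXi 1 * etaR (ψ 1) + etaR (ψ (dXi 1)) := by
  rw [cap_apply, comul_xi1, map_add, contract_inL, contract_inR]

theorem cap_tau0_xi1 : cap ψ (dTau 0 * dXi 1) = dTau 0 * dXi 1 * etaR (ψ 1)
    + dTau 0 * etaR (ψ (dXi 1)) + dXi 1 * etaR (ψ (dTau 0)) + etaR (ψ (dTau 0 * dXi 1)) := by
  have h : comul (dTau 0 * dXi 1) = inL (dTau 0 * dXi 1) + inL (dTau 0) * inR (dXi 1)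
      + inL (dXi 1) * inR (dTau 0) + inR (dTau 0 * dXi 1) := by
    rw [map_mul, comul_tau0, comul_xi1, map_mul, map_mul]; ring
  simp only [cap_apply, h, map_add, contract_inL, contract_inR, contract_tmul]

theorem cap_tau1 : cap ψ (dTau 1) = dTau 1 * etaR (ψ 1) + dXi 1 * etaR (ψ (dTau 0))
    + etaR (ψ (dTau 1)) := by
  simp only [cap_apply, comul_tau1, map_add, contract_inL, contract_inR, contract_tmul]

theorem cap_xi1_sq : cap ψ (dXi 1 ^ 2) = dXi 1 ^ 2 * etaR (ψ 1) + etaR (ψ (dXi 1 ^ 2)) := by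
  have h : comul (dXi 1 ^ 2) = inL (dXi 1 ^ 2) + inR (dXi 1 ^ 2) := by
    have h2 : (2 : Dual2) = 0 := two_eq_zero_of_hom (inL.comp etaL)
    rw [map_pow, comul_xi1, map_pow, map_pow]
    linear_combination inL (dXi 1) * inR (dXi 1) * h2
  simp only [cap_apply, h, map_add, contract_inL, contract_inR]

/-- The product `τ₀ · τ₀` in the right tensor factor is not a basis monomial; `ψ` of it is left
unexpanded and is evaluated with `eval_tau0_sq_mul` for each particular `ψ`. -/
theorem cap_tau0_tau1 : cap ψ (dTau 0 * dTau 1) = dTau 0 * dTau 1 * etaR (ψ 1)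
    + dTau 0 * dXi 1 * etaR (ψ (dTau 0)) + dTau 0 * etaR (ψ (dTau 1))
    + dTau 1 * etaR (ψ (dTau 0)) + dXi 1 * etaR (ψ (dTau 0 * dTau 0))
    + etaR (ψ (dTau 0 * dTau 1)) := by
  have h : comul (dTau 0 * dTau 1) = inL (dTau 0 * dTau 1) + inL (dTau 0 * dXi 1) * inR (dTau 0)
      + inL (dTau 0) * inR (dTau 1) + inL (dTau 1) * inR (dTau 0)
      + inL (dXi 1) * inR (dTau 0 * dTau 0) + inR (dTau 0 * dTau 1) := by
    simp only [map_mul, comul_tau0, comul_tau1]; ring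
  simp only [cap_apply, h, map_add, contract_inL, contract_inR, contract_tmul]

end cap

/-! ### Steenrod squares -/

@[simp] theorem toSmallDual_tau0 : toSmallDual (dTau 0) = QuadraticAlgebra.omega := by
  simp [toSmallDual]

@[simp] theorem toSmallDual_tau1 : toSmallDual (dTau 1) = 0 := by simp [toSmallDual]

@[simp] theorem toSmallDual_xi1 :
    toSmallDual (dXi 1) = algebraMap (Polynomial Coeff) SmallDual Polynomial.X :=
  (Dual.lift_dXi _ _ _ _ 0).trans (by simp)

theorem sq_even_eval (k : ℕ) (x : Dual) :
    (sqFunctional (2 * k)).eval x = (toSmallDual x).re.coeff k := by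
  change (if Even (2 * k) then (toSmallDual x).re.coeff (2 * k / 2)
    else (toSmallDual x).im.coeff (2 * k / 2)) = _
  rw [if_pos (even_two_mul k), Nat.mul_div_cancel_left k two_pos]

theorem sq_odd_eval (k : ℕ) (x : Dual) :
    (sqFunctional (2 * k + 1)).eval x = (toSmallDual x).im.coeff k := by
  change (if Even (2 * k + 1) then (toSmallDual x).re.coeff ((2 * k + 1) / 2)
    else (toSmallDual x).im.coeff ((2 * k + 1) / 2)) = _
  rw [if_neg (by simp), show (2 * k + 1) / 2 = k by omega]

/-- In `SmallDual`, `ω (a + b ω) = τ ξ₁ b + (a + ρ ξ₁ b) ω`. The coefficient of `ξ₁^(k+1)` in the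
real part is therefore `τ` times that of `τ₀ ξ₁^k` in the original element. -/
theorem sq_even_tau0_mul (k : ℕ) (x : Dual) : (sqFunctional (2 * (k + 1))).eval (dTau 0 * x) =
    cTau * (sqFunctional (2 * k + 1)).eval x := by
  rw [sq_even_eval, sq_odd_eval, map_mul, toSmallDual_tau0, QuadraticAlgebra.re_mul]
  simp [mul_assoc]

/-- By the same formula, the constant coefficient of `a + ρ ξ₁ b` is that of `a`. -/
theorem sq_one_tau0_mul (x : Dual) :
    (sqFunctional 1).eval (dTau 0 * x) = (sqFunctional 0).eval x := by
  rw [sq_odd_eval 0, sq_even_eval 0, map_mul, toSmallDual_tau0, QuadraticAlgebra.im_mul]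
  simp [mul_assoc]

theorem toSmallDual_re_one : (toSmallDual 1).re = 1 := by rw [map_one]; rfl

theorem toSmallDual_im_one : (toSmallDual 1).im = 0 := by rw [map_one]; rfl

theorem toSmallDual_xi1_sq : toSmallDual (dXi 1 ^ 2) =
    algebraMap (Polynomial Coeff) SmallDual (Polynomial.X ^ 2) := by
  rw [map_pow, toSmallDual_xi1, map_pow]

/-- Identifies the functional `x ↦ Sq¹(τ₀ x)` with the counit; this is the source of the summand `ρ`
in `Sq¹ τ = τ Sq¹ + ρ`. -/
theorem sq_zero : sqFunctional 0 = 1 := by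
  have h1 : (1 : Functional) ∈ functionalPiece 0 := SetLike.GradedOne.one_mem
  refine functional_ext_low (d := 0) (by simp) (by simpa using! sqFunctional_mem 0) h1 ?_
  have c1 : counit 1 = 1 := map_one _
  have c2 : counit (dXi 1 ^ 2) = 0 := by simp [counit_dXi]
  rintro x (rfl | rfl | rfl | rfl | rfl | rfl | rfl) <;> rw [sq_even_eval 0, eval_one] <;>
    simp [counit_dXi, toSmallDual_re_one, toSmallDual_xi1_sq, c1, c2, -map_pow, -map_one]

theorem sq_one_mul_tau : sqFunctional 1 * cTau • (1 : Functional) =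
    cTau • sqFunctional 1 + cRho • 1 := by
  ext1 x
  rw [eval_mul_tau, sq_one_tau0_mul, sq_zero]; rfl

theorem sq_even_mul_tau (k : ℕ) : sqFunctional (2 * (k + 1)) * cTau • (1 : Functional) =
    cTau • sqFunctional (2 * (k + 1)) + cRho • cTau • sqFunctional (2 * k + 1) := by
  ext1 x
  rw [eval_mul_tau, sq_even_tau0_mul]; rfl

/-! ### Values of the squares and their products on the low monomials -/

theorem sq_one_eval :
    (sqFunctional 1).eval 1 = 0 ∧
    (sqFunctional 1).eval (dTau 0) = 1 ∧
    (sqFunctional 1).eval (dXi 1) = 0 ∧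
    (sqFunctional 1).eval (dTau 0 * dXi 1) = 0 ∧
    (sqFunctional 1).eval (dTau 1) = 0 ∧
    (sqFunctional 1).eval (dXi 1 ^ 2) = 0 ∧
    (sqFunctional 1).eval (dTau 0 * dTau 1) = 0 := by
  have e := fun x : Dual => sq_odd_eval 0 x
  simp only [mul_zero, zero_add] at e
  refine ⟨?_, ?_, ?_, ?_, ?_, ?_, ?_⟩ <;>
    simp [e, Polynomial.coeff_X, Polynomial.coeff_one,
      toSmallDual_im_one, toSmallDual_xi1_sq, -map_one, -map_pow]

theorem sq_two_eval :
    (sqFunctional 2).eval 1 = 0 ∧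
    (sqFunctional 2).eval (dTau 0) = 0 ∧
    (sqFunctional 2).eval (dXi 1) = 1 ∧
    (sqFunctional 2).eval (dTau 0 * dXi 1) = 0 ∧
    (sqFunctional 2).eval (dTau 1) = 0 ∧
    (sqFunctional 2).eval (dXi 1 ^ 2) = 0 ∧
    (sqFunctional 2).eval (dTau 0 * dTau 1) = 0 := by
  have e := fun x : Dual => sq_even_eval 1 x
  simp only [mul_one] at e
  refine ⟨?_, ?_, ?_, ?_, ?_, ?_, ?_⟩ <;>
    simp [e, Polynomial.coeff_X, Polynomial.coeff_X_pow, Polynomial.coeff_one, toSmallDual_re_one,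
      toSmallDual_xi1_sq, -map_one, -map_pow]

theorem sq_three_eval :
    (sqFunctional 3).eval 1 = 0 ∧
    (sqFunctional 3).eval (dTau 0) = 0 ∧
    (sqFunctional 3).eval (dXi 1) = 0 ∧
    (sqFunctional 3).eval (dTau 0 * dXi 1) = 1 ∧
    (sqFunctional 3).eval (dTau 1) = 0 ∧
    (sqFunctional 3).eval (dXi 1 ^ 2) = 0 ∧
    (sqFunctional 3).eval (dTau 0 * dTau 1) = 0 := by
  have e := fun x : Dual => sq_odd_eval 1 x
  simp only [mul_one, Nat.reduceAdd] at e
  refine ⟨?_, ?_, ?_, ?_, ?_, ?_, ?_⟩ <;>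
    simp [e, Polynomial.coeff_X, Polynomial.coeff_one,
      toSmallDual_im_one, toSmallDual_xi1_sq, -map_one, -map_pow]

theorem sq_four_eval :
    (sqFunctional 4).eval 1 = 0 ∧
    (sqFunctional 4).eval (dTau 0) = 0 ∧
    (sqFunctional 4).eval (dXi 1) = 0 ∧
    (sqFunctional 4).eval (dTau 0 * dXi 1) = 0 ∧
    (sqFunctional 4).eval (dTau 1) = 0 ∧
    (sqFunctional 4).eval (dXi 1 ^ 2) = 1 ∧
    (sqFunctional 4).eval (dTau 0 * dTau 1) = 0 := by
  have e := fun x : Dual => sq_even_eval 2 x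
  simp only [Nat.reduceMul] at e
  refine ⟨?_, ?_, ?_, ?_, ?_, ?_, ?_⟩ <;>
    simp [e, Polynomial.coeff_X, Polynomial.coeff_X_pow, Polynomial.coeff_one, toSmallDual_re_one,
      toSmallDual_xi1_sq, -map_one, -map_pow]

theorem sq_one_mul_sq_one_eval :
    (sqFunctional 1 * sqFunctional 1).eval 1 = 0 ∧
    (sqFunctional 1 * sqFunctional 1).eval (dTau 0) = 0 ∧
    (sqFunctional 1 * sqFunctional 1).eval (dXi 1) = 0 ∧
    (sqFunctional 1 * sqFunctional 1).eval (dTau 0 * dXi 1) = 0 ∧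
    (sqFunctional 1 * sqFunctional 1).eval (dTau 1) = 0 ∧
    (sqFunctional 1 * sqFunctional 1).eval (dXi 1 ^ 2) = 0 ∧
    (sqFunctional 1 * sqFunctional 1).eval (dTau 0 * dTau 1) = 0 := by
  obtain ⟨a1, a2, a3, a4, a5, a6, a7⟩ := sq_one_eval
  obtain ⟨b1, b2, b3, b4, b5, b6, b7⟩ := sq_one_eval
  have hb := eval_tau0_sq_mul (sqFunctional 1) 1
  simp only [mul_one, b3, b4, b5, mul_zero, add_zero] at hb
  have ha : (sqFunctional 1).eval (dXi 1 * etaR ((sqFunctional 1).eval (dTau 0 * dTau 0))) = 0 := by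
    simp [hb]
  refine ⟨?_, ?_, ?_, ?_, ?_, ?_, ?_⟩ <;>
    simp [Functional.eval_mul, cap_one, cap_tau0, cap_xi1, cap_tau0_xi1, cap_tau1, cap_xi1_sq,
      cap_tau0_tau1, ha, a1, a2, a3, a4, a5, b6, b7]

theorem sq_one_mul_sq_two_eval :
    (sqFunctional 1 * sqFunctional 2).eval 1 = 0 ∧
    (sqFunctional 1 * sqFunctional 2).eval (dTau 0) = 0 ∧
    (sqFunctional 1 * sqFunctional 2).eval (dXi 1) = 0 ∧
    (sqFunctional 1 * sqFunctional 2).eval (dTau 0 * dXi 1) = 1 ∧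
    (sqFunctional 1 * sqFunctional 2).eval (dTau 1) = 0 ∧
    (sqFunctional 1 * sqFunctional 2).eval (dXi 1 ^ 2) = 0 ∧
    (sqFunctional 1 * sqFunctional 2).eval (dTau 0 * dTau 1) = 0 := by
  obtain ⟨a1, a2, a3, a4, a5, a6, a7⟩ := sq_one_eval
  obtain ⟨b1, b2, b3, b4, b5, b6, b7⟩ := sq_two_eval
  have hb := eval_tau0_sq_mul (sqFunctional 2) 1
  simp only [mul_one, b3, b4, b5, mul_zero, add_zero] at hb
  -- Here `Sq²(τ₀²) = τ`, so the argument is `ξ₁ η_R(τ) = τ ξ₁ + ρ τ₀ ξ₁`, and `Sq¹` kills both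
  -- terms.
  have ha : (sqFunctional 1).eval (dXi 1 * etaR ((sqFunctional 2).eval (dTau 0 * dTau 0))) = 0 := by
    simp [hb, mul_add, mul_left_comm (dXi 1), mul_comm (dXi 1) (etaL _), eval_etaL_mul, a3,
      a4, mul_comm (dXi 1) (dTau 0)]
  refine ⟨?_, ?_, ?_, ?_, ?_, ?_, ?_⟩ <;>
    simp [Functional.eval_mul, cap_one, cap_tau0, cap_xi1, cap_tau0_xi1, cap_tau1, cap_xi1_sq,
      cap_tau0_tau1, ha, a1, a2, b1, b2, b3, b4, b5, b6, b7]

/-- The term `ξ₁ ⊗ τ₀` occurs in the comultiplications of both `τ₀ ξ₁` and `τ₁`; hence the two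
values `1`, and `Sq² Sq¹ ≠ Sq³`. -/
theorem sq_two_mul_sq_one_eval :
    (sqFunctional 2 * sqFunctional 1).eval 1 = 0 ∧
    (sqFunctional 2 * sqFunctional 1).eval (dTau 0) = 0 ∧
    (sqFunctional 2 * sqFunctional 1).eval (dXi 1) = 0 ∧
    (sqFunctional 2 * sqFunctional 1).eval (dTau 0 * dXi 1) = 1 ∧
    (sqFunctional 2 * sqFunctional 1).eval (dTau 1) = 1 ∧
    (sqFunctional 2 * sqFunctional 1).eval (dXi 1 ^ 2) = 0 ∧
    (sqFunctional 2 * sqFunctional 1).eval (dTau 0 * dTau 1) = 0 := by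
  obtain ⟨a1, a2, a3, a4, a5, a6, a7⟩ := sq_two_eval
  obtain ⟨b1, b2, b3, b4, b5, b6, b7⟩ := sq_one_eval
  have hb := eval_tau0_sq_mul (sqFunctional 1) 1
  simp only [mul_one, b3, b4, b5, mul_zero, add_zero] at hb
  have ha : (sqFunctional 2).eval (dXi 1 * etaR ((sqFunctional 1).eval (dTau 0 * dTau 0))) = 0 := by
    simp [hb]
  refine ⟨?_, ?_, ?_, ?_, ?_, ?_, ?_⟩ <;>
    simp [Functional.eval_mul, cap_one, cap_tau0, cap_xi1, cap_tau0_xi1, cap_tau1, cap_xi1_sq,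
      cap_tau0_tau1, ha, a1, a3, a4, a5, b1, b2, b3, b4, b5, b6, b7]

/-- The nonzero value comes from the term `τ₀ ξ₁ ⊗ τ₀` in the comultiplication of `τ₀ τ₁`. -/
theorem sq_three_mul_sq_one_eval :
    (sqFunctional 3 * sqFunctional 1).eval 1 = 0 ∧
    (sqFunctional 3 * sqFunctional 1).eval (dTau 0) = 0 ∧
    (sqFunctional 3 * sqFunctional 1).eval (dXi 1) = 0 ∧
    (sqFunctional 3 * sqFunctional 1).eval (dTau 0 * dXi 1) = 0 ∧
    (sqFunctional 3 * sqFunctional 1).eval (dTau 1) = 0 ∧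
    (sqFunctional 3 * sqFunctional 1).eval (dXi 1 ^ 2) = 0 ∧
    (sqFunctional 3 * sqFunctional 1).eval (dTau 0 * dTau 1) = 1 := by
  obtain ⟨a1, a2, a3, a4, a5, a6, a7⟩ := sq_three_eval
  obtain ⟨b1, b2, b3, b4, b5, b6, b7⟩ := sq_one_eval
  have hb := eval_tau0_sq_mul (sqFunctional 1) 1
  simp only [mul_one, b3, b4, b5, mul_zero, add_zero] at hb
  have ha : (sqFunctional 3).eval (dXi 1 * etaR ((sqFunctional 1).eval (dTau 0 * dTau 0))) = 0 := by
    simp [hb]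
  refine ⟨?_, ?_, ?_, ?_, ?_, ?_, ?_⟩ <;>
    simp [Functional.eval_mul, cap_one, cap_tau0, cap_xi1, cap_tau0_xi1, cap_tau1, cap_xi1_sq,
      cap_tau0_tau1, ha, a1, a3, a4, a5, b1, b2, b3, b4, b5, b6, b7]

theorem lowMonomials_forall {P : Dual → Prop} : (∀ x ∈ lowMonomials, P x) ↔
    P 1 ∧ P (dTau 0) ∧ P (dXi 1) ∧ P (dTau 0 * dXi 1) ∧ P (dTau 1) ∧ P (dXi 1 ^ 2) ∧
      P (dTau 0 * dTau 1) := by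
  simp [lowMonomials]

theorem sq_one_mul_sq_one : sqFunctional 1 * sqFunctional 1 = 0 := by
  have h := sqFunctional_mem 1
  exact functional_ext_low (by norm_num) (SetLike.GradedMul.mul_mem h h) (zero_mem _)
    (lowMonomials_forall.mpr sq_one_mul_sq_one_eval)

theorem sq_one_mul_sq_two : sqFunctional 1 * sqFunctional 2 = sqFunctional 3 := by
  refine functional_ext_low (d := (3, 1)) (by norm_num)
    (mem_of_eq functionalPiece
      (SetLike.GradedMul.mul_mem (sqFunctional_mem 1) (sqFunctional_mem 2)) (by simp))
    (mem_of_eq functionalPiece (sqFunctional_mem 3) (by simp))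
    (lowMonomials_forall.mpr ?_)
  simp [sq_one_mul_sq_two_eval, sq_three_eval]

/-! ### Antiautomorphisms -/

theorem tau_mem : cTau • (1 : Functional) ∈ functionalPiece (0, 1) :=
  mem_of_eq functionalPiece
    (smul_mem_functionalPiece cTau_mem SetLike.GradedOne.one_mem) (by simp)

theorem eq_zero_or_eq_tau {φ : Functional} (hφ : φ ∈ functionalPiece (0, 1)) :
    φ = 0 ∨ φ = cTau • 1 := by
  have t0 := dTau_mem 0
  have t1 := dTau_mem 1
  have x1 := dXi_mem 1
  -- Monomials of positive degree would take values in positive homological degree, where the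
  -- coefficients vanish; only the value at `1` is free.
  have key : ∀ ψ ∈ functionalPiece (0, 1), φ.eval 1 = ψ.eval 1 → φ = ψ := by
    intro ψ hψ h
    have z' : ∀ {x : Dual} {k : ℤ × ℤ}, x ∈ dualPiece k → 0 < k.1 → φ.eval x = ψ.eval x :=
      fun hx hk => (functionalPiece_eval_eq_zero hφ hx (Or.inl hk)).trans
        (functionalPiece_eval_eq_zero hψ hx (Or.inl hk)).symm
    exact functional_ext_low (by norm_num) hφ hψ (lowMonomials_forall.mpr
      ⟨h, z' t0 (by norm_num), z' x1 (by norm_num), z' (dualPiece_mul t0 x1) (by norm_num),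
        z' t1 (by norm_num), z' (SetLike.pow_mem_graded 2 x1) (by norm_num),
        z' (dualPiece_mul t0 t1) (by norm_num)⟩)
  rcases coeffPiece_eq_zero_or (hφ 0 1 SetLike.GradedOne.one_mem) 1 0 (by simp) with h | h
  · exact Or.inl (key 0 (zero_mem _) h)
  · refine Or.inr (key _ tau_mem (h.trans ?_))
    rw [eval_smul, eval_one, map_one counit]; simp

theorem eq_zero_or_eq_sq_one {φ : Functional} (hφ : φ ∈ functionalPiece (1, 0)) :
    φ = 0 ∨ φ = sqFunctional 1 := by
  have t0 := dTau_mem 0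
  have t1 := dTau_mem 1
  have x1 := dXi_mem 1
  -- Higher monomials vanish by degree, and the value at `1` would have bidegree `(-1, 0)`, where
  -- there are no coefficients; only the value at `τ₀`, a scalar in `𝔽₂`, is free.
  have key : ∀ ψ ∈ functionalPiece (1, 0), φ.eval (dTau 0) = ψ.eval (dTau 0) → φ = ψ := by
    intro ψ hψ h
    have z' : ∀ {x : Dual} {k : ℤ × ℤ}, x ∈ dualPiece k → 1 < k.1 ∨ k.1 - 1 < k.2 - 0 →
        φ.eval x = ψ.eval x :=
      fun hx hk => (functionalPiece_eval_eq_zero hφ hx hk).trans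
        (functionalPiece_eval_eq_zero hψ hx hk).symm
    exact functional_ext_low (by norm_num) hφ hψ (lowMonomials_forall.mpr
      ⟨z' SetLike.GradedOne.one_mem (by norm_num), h, z' x1 (by norm_num),
        z' (dualPiece_mul t0 x1) (by norm_num), z' t1 (by norm_num),
        z' (SetLike.pow_mem_graded 2 x1) (by norm_num),
        z' (dualPiece_mul t0 t1) (by norm_num)⟩)
  rcases coeffPiece_eq_zero_or (hφ _ _ t0) 0 0 (by ext <;> simp) with h | h
  · exact Or.inl (key 0 (zero_mem _) h)
  · refine Or.inr (key _ (sqFunctional_mem 1) (h.trans ?_))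
    rw [sq_one_eval.2.1]; simp

theorem tau_ne_zero : cTau • (1 : Functional) ≠ 0 := by
  intro h
  have := congrArg (fun φ : Functional => φ.eval 1) h
  simp only [eval_smul, eval_one, map_one counit, mul_one] at this
  exact MvPolynomial.X_ne_zero 0 this

theorem sq_one_ne_zero : sqFunctional 1 ≠ 0 := by
  intro h
  have h' := sq_one_eval.2.1
  rw [h] at h'
  exact zero_ne_one h'

theorem rho_mul_cancel {a b : Coeff} (h : cRho * a = cRho * b) : a = b :=
  mul_left_cancel₀ (MvPolynomial.X_ne_zero 1) h

theorem functional_add_self (φ : Functional) : φ + φ = 0 := by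
  have h2 : (2 : Coeff) = 0 := CharTwo.two_eq_zero
  rw [← two_smul Coeff φ, h2, zero_smul]

/-- A functional `φ` of bidegree `(2, 1)` with `φ τ = τ φ + ρ τ Sq¹ + ρ²` is
`Sq² + ρ Sq¹`. -/
theorem eq_of_commutator_two {φ : Functional} (hφ : φ ∈ functionalPiece (2, 1))
    (h : ∀ x, φ.eval (dTau 0 * x) = (cTau • sqFunctional 1 + cRho • 1).eval x) :
    φ = sqFunctional 2 + cRho • sqFunctional 1 := by
  have t0 := dTau_mem 0
  have t1 := dTau_mem 1
  have x1 := dXi_mem 1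
  obtain ⟨a1, a2, a3, a4, a5, a6, a7⟩ := sq_one_eval
  obtain ⟨b1, b2, b3, b4, b5, b6, b7⟩ := sq_two_eval
  have hψ : sqFunctional 2 + cRho • sqFunctional 1 ∈ functionalPiece (2, 1) :=
    add_mem (mem_of_eq functionalPiece (sqFunctional_mem 2) (by simp))
      (mem_of_eq functionalPiece (smul_mem_functionalPiece cRho_mem (sqFunctional_mem 1))
        (by simp))
  have v1 : φ.eval (dTau 0) = cRho := by
    have := h 1
    simpa [eval_add, eval_smul, a1, eval_one, map_one counit] using this
  have z5 : φ.eval (dTau 1) = 0 := functionalPiece_eval_eq_zero hφ t1 (by norm_num)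
  have z4 : φ.eval (dTau 0 * dXi 1) = 0 :=
    functionalPiece_eval_eq_zero hφ (dualPiece_mul t0 x1) (by norm_num)
  -- Taking `x = τ₀`, the relation for `τ₀²` reduces the hypothesis to `τ φ(ξ₁) = τ`.
  have v2 : φ.eval (dXi 1) = 1 := by
    have h1 := h (dTau 0)
    have h2 := eval_tau0_sq_mul φ 1
    simp only [mul_one] at h2
    rw [h2, z4, z5] at h1
    simp only [mul_zero, add_zero, eval_add, eval_smul, a2, eval_one, counit_dTau] at h1
    exact mul_left_cancel₀ (MvPolynomial.X_ne_zero 0) h1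
  refine functional_ext_low (by norm_num) hφ hψ
    (lowMonomials_forall.mpr ⟨?_, ?_, ?_, ?_, ?_, ?_, ?_⟩)
  · rw [functionalPiece_eval_eq_zero hφ SetLike.GradedOne.one_mem (by norm_num)]
    simp [eval_add, eval_smul, a1, b1]
  · simp [eval_add, eval_smul, a2, b2, v1]
  · simp [eval_add, eval_smul, a3, b3, v2]
  · simp [eval_add, eval_smul, a4, b4, z4]
  · simp [eval_add, eval_smul, a5, b5, z5]
  · rw [functionalPiece_eval_eq_zero hφ (SetLike.pow_mem_graded 2 x1) (by norm_num)]
    simp [eval_add, eval_smul, a6, b6]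
  · rw [functionalPiece_eval_eq_zero hφ (dualPiece_mul t0 t1) (by norm_num)]
    simp [eval_add, eval_smul, a7, b7]

/-- A functional `φ` of bidegree `(4, 2)` with `φ τ = τ φ + ρ τ Sq² Sq¹ + ρ² Sq²` is
`Sq⁴ + ρ Sq² Sq¹ + τ Sq³ Sq¹`. -/
theorem eq_of_commutator_four {φ : Functional} (hφ : φ ∈ functionalPiece (4, 2))
    (h : ∀ x, φ.eval (dTau 0 * x) =
      (cTau • (sqFunctional 2 * sqFunctional 1) + cRho • sqFunctional 2).eval x) :
    φ = sqFunctional 4 + cRho • (sqFunctional 2 * sqFunctional 1)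
      + cTau • (sqFunctional 3 * sqFunctional 1) := by
  have t0 := dTau_mem 0
  have t1 := dTau_mem 1
  have x1 := dXi_mem 1
  obtain ⟨a1, a2, a3, a4, a5, a6, a7⟩ := sq_two_mul_sq_one_eval
  obtain ⟨b1, b2, b3, b4, b5, b6, b7⟩ := sq_two_eval
  obtain ⟨c1, c2, c3, c4, c5, c6, c7⟩ := sq_three_mul_sq_one_eval
  obtain ⟨e1, e2, e3, e4, e5, e6, e7⟩ := sq_four_eval
  have m1 := sqFunctional_mem 1
  have hψ : sqFunctional 4 + cRho • (sqFunctional 2 * sqFunctional 1)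
      + cTau • (sqFunctional 3 * sqFunctional 1) ∈ functionalPiece (4, 2) :=
    add_mem (add_mem (mem_of_eq functionalPiece (sqFunctional_mem 4) (by simp))
      (mem_of_eq functionalPiece (smul_mem_functionalPiece cRho_mem
        (SetLike.GradedMul.mul_mem (sqFunctional_mem 2) m1)) (by simp)))
      (mem_of_eq functionalPiece (smul_mem_functionalPiece cTau_mem
        (SetLike.GradedMul.mul_mem (sqFunctional_mem 3) m1)) (by simp))
  have z3 : φ.eval (dXi 1) = 0 := functionalPiece_eval_eq_zero hφ x1 (by norm_num)
  have v4 : φ.eval (dTau 0 * dXi 1) = cRho := by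
    simpa [eval_add, eval_smul, a3, b3] using h (dXi 1)
  have v7 : φ.eval (dTau 0 * dTau 1) = cTau := by
    simpa [eval_add, eval_smul, a5, b5] using h (dTau 1)
  -- With `x = τ₀` the hypothesis reads `ρ φ(τ₀ ξ₁) + ρ φ(τ₁) = 0`, and `φ(τ₀ ξ₁) = ρ` is known.
  have v5 : φ.eval (dTau 1) = cRho := by
    have h1 := h (dTau 0)
    have h2 := eval_tau0_sq_mul φ 1
    simp only [mul_one] at h2
    rw [h2, z3, v4] at h1
    simp only [mul_zero, zero_add, eval_add, eval_smul, a2, b2] at h1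
    refine rho_mul_cancel ?_
    rw [← sub_eq_zero, CharTwo.sub_eq_add, add_comm, h1]
  -- With `x = τ₀ ξ₁` the terms `τ₀ ξ₁²` and `τ₁ ξ₁` have degree `5` and are killed, leaving `τ
  -- φ(ξ₁²) = τ`.
  have v6 : φ.eval (dXi 1 ^ 2) = 1 := by
    have h1 := h (dTau 0 * dXi 1)
    rw [eval_tau0_sq_mul, ← pow_two,
      functionalPiece_eval_eq_zero hφ (dualPiece_mul t0 (SetLike.pow_mem_graded 2 x1))
        (by norm_num),
      functionalPiece_eval_eq_zero hφ (dualPiece_mul t1 x1) (by norm_num)] at h1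
    simp only [mul_zero, add_zero, eval_add, eval_smul, a4, b4] at h1
    exact mul_left_cancel₀ (MvPolynomial.X_ne_zero 0) h1
  refine functional_ext_low (by norm_num) hφ hψ
    (lowMonomials_forall.mpr ⟨?_, ?_, ?_, ?_, ?_, ?_, ?_⟩)
  · rw [functionalPiece_eval_eq_zero hφ SetLike.GradedOne.one_mem (by norm_num)]
    simp [eval_add, eval_smul, a1, c1, e1]
  · rw [functionalPiece_eval_eq_zero hφ t0 (by norm_num)]
    simp [eval_add, eval_smul, a2, c2, e2]
  · simp [eval_add, eval_smul, a3, c3, e3, z3]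
  · simp [eval_add, eval_smul, a4, c4, e4, v4]
  · simp [eval_add, eval_smul, a5, c5, e5, v5]
  · simp [eval_add, eval_smul, a6, c6, e6, v6]
  · simp [eval_add, eval_smul, a7, c7, e7, v7]

/-! ### Commutation relations in the Steenrod algebra -/

namespace Steenrod

theorem add_self (x : Steenrod) : x + x = 0 := Subtype.ext (functional_add_self _)

theorem coe_tau_mul (x : Steenrod) : ((tau * x : Steenrod) : Functional) = cTau • x.1 :=
  congrArg (cTau • ·) (one_mul x.1)

theorem coe_rho_mul (x : Steenrod) : ((rho * x : Steenrod) : Functional) = cRho • x.1 :=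
  congrArg (cRho • ·) (one_mul x.1)

theorem mul_rho (x : Steenrod) : x * rho = rho * x :=
  Subtype.ext ((functional_mul_rho x.1).trans (coe_rho_mul x).symm)

theorem Sq_one_mul_tau : Sq 1 * tau = tau * Sq 1 + rho := by
  refine Subtype.ext (sq_one_mul_tau.trans ?_)
  rw [Subring.coe_add, coe_tau_mul]; rfl

theorem Sq_two_mul_tau : Sq 2 * tau = tau * Sq 2 + rho * (tau * Sq 1) := by
  refine Subtype.ext ((sq_even_mul_tau 0).trans ?_)
  rw [Subring.coe_add, coe_rho_mul, coe_tau_mul, coe_tau_mul]; rfl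

theorem Sq_four_mul_tau : Sq 4 * tau = tau * Sq 4 + rho * (tau * Sq 3) := by
  refine Subtype.ext ((sq_even_mul_tau 1).trans ?_)
  rw [Subring.coe_add, coe_rho_mul, coe_tau_mul, coe_tau_mul]; rfl

theorem Sq_one_mul_Sq_one : Sq 1 * Sq 1 = 0 := Subtype.ext sq_one_mul_sq_one

theorem Sq_one_mul_Sq_two : Sq 1 * Sq 2 = Sq 3 := Subtype.ext sq_one_mul_sq_two

/-- Compare with `eval_mul_tau` and cancel `ρ`, a nonzerodivisor on coefficients. -/
theorem eval_tau0_mul_of_mul_tau {x z : Steenrod} (h : x * tau = tau * x + rho * z) (a : Dual) :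
    x.1.eval (dTau 0 * a) = z.1.eval a := by
  have h1 : (x.1 * cTau • (1 : Functional)).eval a = (cTau • x.1 + cRho • z.1).eval a := by
    rw [← coe_tau_mul, ← coe_rho_mul, ← Subring.coe_add, ← h]; rfl
  rw [eval_mul_tau, eval_add, eval_smul, eval_smul] at h1
  exact rho_mul_cancel (add_left_cancel h1)

end Steenrod

end RMotivic

end

/-! ### The values of the antiautomorphism -/

open RMotivic Steenrod in
theorem mainTheorem9 (χ : RMotivic.Steenrod →+ RMotivic.Steenrod)
    (hone : χ 1 = 1)
    (hmul : ∀ x y, χ (x * y) = χ y * χ x)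
    (hinv : Function.Involutive χ)
    (hdeg : ∀ d, ∀ x ∈ RMotivic.Steenrod.piece d, χ x ∈ RMotivic.Steenrod.piece d) :
    χ RMotivic.Steenrod.tau = RMotivic.Steenrod.tau ∧ χ RMotivic.Steenrod.rho = RMotivic.Steenrod.rho ∧ χ (RMotivic.Steenrod.Sq 1) = RMotivic.Steenrod.Sq 1 ∧
      χ (RMotivic.Steenrod.Sq 2) = RMotivic.Steenrod.Sq 2 + RMotivic.Steenrod.rho * RMotivic.Steenrod.Sq 1 ∧
      χ (RMotivic.Steenrod.Sq 4) = RMotivic.Steenrod.Sq 4 + RMotivic.Steenrod.rho * RMotivic.Steenrod.Sq 2 * RMotivic.Steenrod.Sq 1 + RMotivic.Steenrod.tau * RMotivic.Steenrod.Sq 1 * RMotivic.Steenrod.Sq 2 * RMotivic.Steenrod.Sq 1 := by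
  have hne : ∀ x : Steenrod, x ≠ 0 → χ x ≠ 0 := fun x hx h =>
    hx (hinv.injective (h.trans (map_zero χ).symm))
  have htau : χ tau = tau := by
    have hm : (χ tau).1 ∈ functionalPiece (0, 1) := hdeg (0, 1) tau tau_mem
    rcases eq_zero_or_eq_tau hm with h | h
    · exact absurd (Subtype.ext h) (hne tau fun h => tau_ne_zero (congrArg Subtype.val h))
    · exact Subtype.ext h
  have hsq1 : χ (Sq 1) = Sq 1 := by
    have hm : (χ (Sq 1)).1 ∈ functionalPiece (1, 0) := hdeg (1, 0) (Sq 1) (sqFunctional_mem 1)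
    rcases eq_zero_or_eq_sq_one hm with h | h
    · exact absurd (Subtype.ext h) (hne (Sq 1) fun h => sq_one_ne_zero (congrArg Subtype.val h))
    · exact Subtype.ext h
  have hrho : χ rho = rho := by
    have h1 : χ (tau * Sq 1) = tau * Sq 1 + rho := by rw [hmul, htau, hsq1, Sq_one_mul_tau]
    have h2 : χ (Sq 1 * tau) = tau * Sq 1 := by rw [hmul, htau, hsq1]
    rw [Sq_one_mul_tau, map_add, h1, add_assoc] at h2
    have h3 : rho + χ rho = 0 := add_eq_left.mp h2
    exact (add_left_cancel (h3.trans (add_self rho).symm))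
  have hsq2 : χ (Sq 2) = Sq 2 + rho * Sq 1 := by
    have hm : (χ (Sq 2)).1 ∈ functionalPiece (2, 1) := hdeg (2, 1) (Sq 2) (sqFunctional_mem 2)
    have h1 := congrArg χ Sq_two_mul_tau
    simp only [map_add, hmul, htau, hsq1, hrho, Sq_one_mul_tau] at h1
    -- Reversing the products gives `τ χ(Sq²) = χ(Sq²) τ + (τ Sq¹ + ρ) ρ`; in characteristic `2`
    -- with `ρ` central, the last term may change sides.
    have h2 : χ (Sq 2) * tau = tau * χ (Sq 2) + rho * (tau * Sq 1 + rho) := by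
      rw [h1, mul_rho, add_assoc, add_self, add_zero]
    refine Subtype.ext ((eq_of_commutator_two hm fun x => ?_).trans ?_)
    · rw [eval_tau0_mul_of_mul_tau h2, Subring.coe_add, coe_tau_mul]; rfl
    · rw [Subring.coe_add, coe_rho_mul]; rfl
  refine ⟨htau, hrho, hsq1, hsq2, ?_⟩
  have hm : (χ (Sq 4)).1 ∈ functionalPiece (4, 2) := hdeg (4, 2) (Sq 4) (sqFunctional_mem 4)
  -- `Sq³ = Sq¹ Sq²` is reversed to `(Sq² + ρ Sq¹) Sq¹`, and `Sq¹ Sq¹ = 0` removes the correction.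
  have hsq3 : χ (Sq 3) = Sq 2 * Sq 1 := by
    rw [← Sq_one_mul_Sq_two, hmul, hsq1, hsq2, add_mul, mul_assoc, Sq_one_mul_Sq_one, mul_zero,
      add_zero]
  have h1 := congrArg χ Sq_four_mul_tau
  simp only [map_add, hmul, htau, hrho, hsq3] at h1
  -- Moving `τ` left past `Sq¹` and then `Sq²` creates `ρ Sq²` and `ρ τ Sq¹ Sq¹ = 0`.
  have h3 : Sq 2 * Sq 1 * tau = tau * (Sq 2 * Sq 1) + rho * Sq 2 := by
    rw [mul_assoc, Sq_one_mul_tau, mul_add, ← mul_assoc, Sq_two_mul_tau, mul_rho, add_mul,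
      mul_assoc, mul_assoc rho, mul_assoc tau (Sq 1), Sq_one_mul_Sq_one, mul_zero, mul_zero,
      add_zero]
  have h2 : χ (Sq 4) * tau = tau * χ (Sq 4) + rho * (tau * (Sq 2 * Sq 1) + rho * Sq 2) := by
    rw [h1, mul_rho, h3, add_assoc, add_self, add_zero]
  refine Subtype.ext ((eq_of_commutator_four hm fun x => ?_).trans ?_)
  · rw [eval_tau0_mul_of_mul_tau h2, Subring.coe_add, coe_tau_mul, coe_rho_mul]; rfl
  · rw [mul_assoc rho, mul_assoc tau, mul_assoc tau, Sq_one_mul_Sq_two, Subring.coe_add,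
      Subring.coe_add, coe_rho_mul, coe_tau_mul]
    rfl
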